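/- Let $(\mathcal V,\otimes,I)$ be a locally presentable symmetric monoidal closed category with internal hom $[-,-]$. Conventions. For a comonoid $C$ and a monoid $B$ in $\mathcal V$, $[C,B]$ carries the convolution monoid structure, with multiplication $[C,B]\otimes[C,B]\to[C\otimes C,B\otimes B]\xrightarrow{[\Delta,m]}[C,B]$ and unit $I\to[I,I]\xrightarrow{[\epsilon,\eta]}[C,B]$; this gives a functor $[-,B]\colon\mathbf{Comon}(\mathcal V)^{\mathrm{op}}\to\mathbf{Mon}(\mathcal V)$. Let $\mathbf{Mod}$ be the category whose objects $M_A$ are monoids $A$ together with a left $A$-module $M$, and whose morphisms $M_A\to N_B$ are pairs $(f\colon A\to B,\ p\colon M\to N)$ with $f$ a monoid morphism, $p$ a morphism of $\mathcal V$ and $p\circ\mu_M=\mu_N\circ(f\otimes p)$. Dually, let $\mathbf{Comod}$ be the category whose objects $X_C$ are comonoids $C$ together with a left $C$-comodule $\delta\colon X\to C\otimes X$, and whose morphisms $X_C\to Y_D$ are pairs $(g\colon C\to D,\ k\colon X\to Y)$ with $g$ a comonoid morphism, $k$ a morphism of $\mathcal V$ and $\delta_Y\circ k=(g\otimes k)\circ\delta_X$.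 (Since $\mathcal V$ is symmetric, the global category of right comodules is isomorphic to $\mathbf{Comod}$, by replacing each comonoid by its co-opposite.) Let $G\colon\mathbf{Mod}\to\mathbf{Mon}(\mathcal V)$, $M_A\mapsto A$, and $V\colon\mathbf{Comod}\to\mathbf{Comon}(\mathcal V)$, $X_C\mapsto C$, be the forgetful functors. For a $B$-module $N$, let $\mathrm{Hom}(-,N_B)\colon\mathbf{Comod}^{\mathrm{op}}\to\mathbf{Mod}$ be the functor sending $X_C$ to the $[C,B]$-module $[X,N]$ with action $[C,B]\otimes[X,N]\to[C\otimes X,B\otimes N]\xrightarrow{[\delta,\mu]}[X,N]$, and a morphism $(g,k)$ to $([g,B],[k,N])$. Proposition. Let $B$ be a monoid in $\mathcal V$ and $N$ a left $B$-module. (1) The functor $[-,B]^{\mathrm{op}}\colon\mathbf{Comon}(\mathcal V)\to\mathbf{Mon}(\mathcal V)^{\mathrm{op}}$ has a right adjoint $P(-,B)$; its value $P(A,B)$ is the universal measuring comonoid. (2) For every right adjoint $P(-,B)$ of $[-,B]^{\mathrm{op}}$, with a chosen adjunction, the functor $\mathrm{Hom}(-,N_B)^{\mathrm{op}}\colon\mathbf{Comod}\to\mathbf{Mod}^{\mathrm{op}}$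 has a right adjoint $Q(-,N_B)\colon\mathbf{Mod}^{\mathrm{op}}\to\mathbf{Comod}$ such that the adjunction $\mathrm{Hom}(-,N_B)^{\mathrm{op}}\dashv Q(-,N_B)$ lies over $[-,B]^{\mathrm{op}}\dashv P(-,B)$. That is, $G^{\mathrm{op}}\circ\mathrm{Hom}(-,N_B)^{\mathrm{op}}=[-,B]^{\mathrm{op}}\circ V$ and $V\circ Q(-,N_B)=P(-,B)\circ G^{\mathrm{op}}$, the functor $V$ sends the unit of the upper adjunction to the unit of the lower one, and $G^{\mathrm{op}}$ sends the counit of the upper adjunction to the counit of the lower one. In particular, for every monoid $A$ and $A$-module $M$, the universal measuring comodule $Q(M,N)$ is a comodule over $P(A,B)$. -/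

import Mathlib

universe v u v₁ v₂ v₃ v₄ u₁ u₂ u₃ u₄

open CategoryTheory MonoidalCategory Opposite

namespace MeasuringComodule



open scoped MonObj ComonObj ModObj

section Global

variable {V : Type u} [Category.{v} V] [MonoidalCategory V]

/-- A (left) comodule over a comonoid object `C`: an object `X` with a counital and coassociative
coaction `X ⟶ C ⊗ X`. -/
class ComodObj (C : V) [ComonObj C] (X : V) where
  /-- The coaction. -/
  coact : X ⟶ C ⊗ X
  counit_coact : coact ≫ ε[C] ▷ X = (λ_ X).inv
  coassoc : coact ≫ C ◁ coact = coact ≫ Δ[C] ▷ X ≫ (α_ C C X).hom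

variable (V) in
/-- Objects of the global category of comodules: a comonoid together with a comodule over it. -/
structure ComodTotal where
  /-- The comonoid. -/
  comon : Comon V
  /-- The underlying object of the comodule. -/
  X : V
  [comod : ComodObj comon.X X]

attribute [instance] ComodTotal.comod

/-- The coaction of an object of the global category of comodules. -/
def ComodTotal.coact (X : ComodTotal V) : X.X ⟶ X.comon.X ⊗ X.X :=
  ComodObj.coact

/-- A morphism `X_C ⟶ Y_D` of comodules over varying comonoids: a comonoid morphism `g : C ⟶ D`
and a morphism `k : X ⟶ Y` compatible with the coactions. -/
@[ext]
structure ComodTotal.Hom (X Y : ComodTotal V) where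
  /-- The comonoid morphism. -/
  base : X.comon ⟶ Y.comon
  /-- The morphism between the underlying objects. -/
  hom : X.X ⟶ Y.X
  comm : hom ≫ Y.coact = X.coact ≫ base.hom ▷ X.X ≫ Y.comon.X ◁ hom

/-- The global category of comodules over all comonoids in `V`. -/
instance : Category (ComodTotal V) where
  Hom := ComodTotal.Hom
  id X := ⟨𝟙 _, 𝟙 _, by simp⟩
  comp f g := ⟨f.base ≫ g.base, f.hom ≫ g.hom, by
    simp [g.comm, reassoc_of% f.comm, whisker_exchange_assoc]⟩

@[ext]
lemma ComodTotal.hom_ext {X Y : ComodTotal V} {f g : X ⟶ Y} (h₁ : f.base = g.base) (h₂ : f.hom = g.hom) :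
    f = g :=
  ComodTotal.Hom.ext h₁ h₂

@[simp] lemma ComodTotal.id_base (X : ComodTotal V) : ComodTotal.Hom.base (𝟙 X) = 𝟙 X.comon := rfl
@[simp] lemma ComodTotal.id_hom (X : ComodTotal V) : ComodTotal.Hom.hom (𝟙 X) = 𝟙 X.X := rfl
@[simp] lemma ComodTotal.comp_base {X Y Z : ComodTotal V} (f : X ⟶ Y) (g : Y ⟶ Z) :
    (f ≫ g).base = f.base ≫ g.base := rfl
@[simp] lemma ComodTotal.comp_hom {X Y Z : ComodTotal V} (f : X ⟶ Y) (g : Y ⟶ Z) :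
    (f ≫ g).hom = f.hom ≫ g.hom := rfl

variable (V) in
/-- The forgetful functor sending `X_C` to its comonoid `C`. -/
@[simps]
def ComodTotal.toComon : ComodTotal V ⥤ Comon V where
  obj X := X.comon
  map f := f.base

variable (V) in
/-- Objects of the global category of modules: a monoid together with a (left) module over it. -/
structure ModTotal where
  /-- The monoid. -/
  mon : Mon V
  /-- The underlying object of the module. -/
  X : V
  [mod : ModObj mon.X X]

attribute [instance] ModTotal.mod

/-- The action of an object of the global category of modules. -/
def ModTotal.act (M : ModTotal V) : M.mon.X ⊗ M.X ⟶ M.X :=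
  ModObj.smul (M := M.mon.X) (X := M.X)

lemma ModTotal.one_act (M : ModTotal V) : η[M.mon.X] ▷ M.X ≫ M.act = (λ_ M.X).hom :=
  ModObj.one_smul (M := M.mon.X) M.X

lemma ModTotal.mul_act (M : ModTotal V) :
    μ[M.mon.X] ▷ M.X ≫ M.act = (α_ _ _ _).hom ≫ M.mon.X ◁ M.act ≫ M.act :=
  ModObj.mul_smul (M := M.mon.X) M.X

/-- A morphism `M_A ⟶ N_B` of modules over varying monoids: a monoid morphism `f : A ⟶ B`
and a morphism `p : M ⟶ N` compatible with the actions. -/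
@[ext]
structure ModTotal.Hom (M N : ModTotal V) where
  /-- The monoid morphism. -/
  base : M.mon ⟶ N.mon
  /-- The morphism between the underlying objects. -/
  hom : M.X ⟶ N.X
  comm : M.act ≫ hom = base.hom ▷ M.X ≫ N.mon.X ◁ hom ≫ N.act

/-- The global category of modules over all monoids in `V`. -/
instance : Category (ModTotal V) where
  Hom := ModTotal.Hom
  id X := ⟨𝟙 _, 𝟙 _, by simp⟩
  comp f g := ⟨f.base ≫ g.base, f.hom ≫ g.hom, by
    simp [g.comm, reassoc_of% f.comm, whisker_exchange_assoc]⟩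

@[ext]
lemma ModTotal.hom_ext {X Y : ModTotal V} {f g : X ⟶ Y} (h₁ : f.base = g.base) (h₂ : f.hom = g.hom) :
    f = g :=
  ModTotal.Hom.ext h₁ h₂

@[simp] lemma ModTotal.id_base (X : ModTotal V) : ModTotal.Hom.base (𝟙 X) = 𝟙 X.mon := rfl
@[simp] lemma ModTotal.id_hom (X : ModTotal V) : ModTotal.Hom.hom (𝟙 X) = 𝟙 X.X := rfl
@[simp] lemma ModTotal.comp_base {X Y Z : ModTotal V} (f : X ⟶ Y) (g : Y ⟶ Z) :
    (f ≫ g).base = f.base ≫ g.base := rfl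
@[simp] lemma ModTotal.comp_hom {X Y Z : ModTotal V} (f : X ⟶ Y) (g : Y ⟶ Z) :
    (f ≫ g).hom = f.hom ≫ g.hom := rfl

variable (V) in
/-- The forgetful functor sending `M_A` to its monoid `A`. -/
@[simps]
def ModTotal.toMon : ModTotal V ⥤ Mon V where
  obj M := M.mon
  map f := f.base

end Global

section Auxiliary

variable {V : Type u} [Category.{v} V] [MonoidalCategory V] [BraidedCategory V]

lemma counit_action_aux {C X B N H : V} (e : C ⟶ 𝟙_ V) (n : 𝟙_ V ⟶ B) (d : X ⟶ C ⊗ X)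
    (m : B ⊗ N ⟶ N) (f : X ⊗ H ⟶ N) (hd : d ≫ e ▷ X = (λ_ X).inv)
    (hm : n ▷ N ≫ m = (λ_ N).hom) :
    d ▷ (𝟙_ V ⊗ H) ≫ tensorμ C X (𝟙_ V) H ≫
      (e ▷ 𝟙_ V ≫ (λ_ (𝟙_ V)).hom ≫ n ⊗ₘ f) ≫ m = X ◁ (λ_ H).hom ≫ f := by
  have h : (e ▷ 𝟙_ V ≫ (λ_ (𝟙_ V)).hom ≫ n ⊗ₘ f) =
      (e ▷ 𝟙_ V ⊗ₘ 𝟙 X ▷ H) ≫ (λ_ (𝟙_ V)).hom ▷ _ ≫ 𝟙_ V ◁ f ≫ n ▷ N := by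
    simp only [← tensorHom_id, ← id_tensorHom, tensorHom_comp_tensorHom, Category.id_comp,
      Category.comp_id, id_tensorHom_id]
  have h' : tensorμ (𝟙_ V) X (𝟙_ V) H ≫ (λ_ (𝟙_ V)).hom ▷ (X ⊗ H) =
      ((λ_ X).hom ⊗ₘ (λ_ _).hom) ≫ (λ_ _).inv := by
    rw [leftUnitor_monoidal]; simp
  rw [h, Category.assoc, Category.assoc, Category.assoc, ← tensorμ_natural_left_assoc, hm,
    tensorHom_id, ← comp_whiskerRight_assoc, hd, reassoc_of% h']
  simp [MonoidalCategory.tensorHom_def]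

lemma action_counit_aux {C X B N H : V} (e : C ⟶ 𝟙_ V) (n : 𝟙_ V ⟶ B) (d : X ⟶ X ⊗ C)
    (m : N ⊗ B ⟶ N) (f : X ⊗ H ⟶ N) (hd : d ≫ X ◁ e = (ρ_ X).inv)
    (hm : N ◁ n ≫ m = (ρ_ N).hom) :
    d ▷ (H ⊗ 𝟙_ V) ≫ tensorμ X C H (𝟙_ V) ≫
      (f ⊗ₘ e ▷ 𝟙_ V ≫ (λ_ (𝟙_ V)).hom ≫ n) ≫ m = X ◁ (ρ_ H).hom ≫ f := by
  have h : (f ⊗ₘ e ▷ 𝟙_ V ≫ (λ_ (𝟙_ V)).hom ≫ n) =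
      (𝟙 X ▷ H ⊗ₘ e ▷ 𝟙_ V) ≫ _ ◁ (λ_ (𝟙_ V)).hom ≫ f ▷ 𝟙_ V ≫ N ◁ n := by
    simp only [← tensorHom_id, ← id_tensorHom, tensorHom_comp_tensorHom, Category.id_comp,
      Category.comp_id, id_tensorHom_id]
  have h' : tensorμ X (𝟙_ V) H (𝟙_ V) ≫ (X ⊗ H) ◁ (λ_ (𝟙_ V)).hom =
      ((ρ_ X).hom ⊗ₘ (ρ_ _).hom) ≫ (ρ_ _).inv := by
    rw [rightUnitor_monoidal]; simp
  rw [h, Category.assoc, Category.assoc, Category.assoc, ← tensorμ_natural_left_assoc, hm,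
    id_tensorHom, ← comp_whiskerRight_assoc, hd, reassoc_of% h']
  simp [MonoidalCategory.tensorHom_def]

lemma assoc_action_aux {C C' D X Y Z A A' B L M N P Q R : V}
    (d : D ⟶ C ⊗ C') (e : Z ⟶ D ⊗ X) (d' : Y ⟶ C' ⊗ X) (e' : Z ⟶ C ⊗ Y)
    (m : A ⊗ A' ⟶ B) (n : B ⊗ L ⟶ N) (m' : A' ⊗ L ⟶ M) (n' : A ⊗ M ⟶ N)
    (f : C ⊗ P ⟶ A) (g : C' ⊗ Q ⟶ A') (h : X ⊗ R ⟶ L)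
    (hd : e' ≫ C ◁ d' = e ≫ d ▷ X ≫ (α_ C C' X).hom)
    (hm : m ▷ L ≫ n = (α_ A A' L).hom ≫ A ◁ m' ≫ n') :
    e ▷ ((P ⊗ Q) ⊗ R) ≫ tensorμ D X (P ⊗ Q) R ≫
        (d ▷ (P ⊗ Q) ≫ tensorμ C C' P Q ≫ (f ⊗ₘ g) ≫ m ⊗ₘ h) ≫ n =
      Z ◁ (α_ P Q R).hom ≫ e' ▷ (P ⊗ Q ⊗ R) ≫ tensorμ C Y P (Q ⊗ R) ≫
        (f ⊗ₘ d' ▷ (Q ⊗ R) ≫ tensorμ C' X Q R ≫ (g ⊗ₘ h) ≫ m') ≫ n' := by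
  have h₁ : (d ▷ (P ⊗ Q) ≫ tensorμ C C' P Q ≫ (f ⊗ₘ g) ≫ m ⊗ₘ h) =
      (d ▷ _ ⊗ₘ 𝟙 X ▷ _) ≫ tensorμ C C' _ _ ▷ _ ≫ ((f ⊗ₘ g) ⊗ₘ h) ≫ m ▷ L := by
    simp only [← tensorHom_id, tensorHom_comp_tensorHom, Category.id_comp,
      Category.comp_id, id_tensorHom_id]
  have h₂ : (f ⊗ₘ d' ▷ (Q ⊗ R) ≫ tensorμ C' X Q R ≫ (g ⊗ₘ h) ≫ m') =
      (𝟙 C ▷ _ ⊗ₘ d' ▷ _) ≫ _ ◁ tensorμ C' X _ _ ≫ (f ⊗ₘ g ⊗ₘ h) ≫ A ◁ m' := by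
    simp only [← tensorHom_id, ← id_tensorHom, tensorHom_comp_tensorHom, Category.id_comp,
      Category.comp_id, id_tensorHom_id]
  rw [h₁, h₂]
  simp only [Category.assoc]
  rw [← tensorμ_natural_left_assoc, ← tensorμ_natural_left_assoc, hm, id_tensorHom, tensorHom_id,
    ← comp_whiskerRight_assoc, ← comp_whiskerRight_assoc, hd,
    MonoidalCategory.associator_naturality_assoc, associator_monoidal_assoc,
    whisker_exchange_assoc]
  simp [MonoidalCategory.tensorHom_def]

end Auxiliary

section Convolution

variable {V : Type u} [Category.{v} V] [MonoidalCategory V]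

open MonoidalClosed

variable (V) in
/-- The lax monoidal unit `I ⟶ [I, I]` of the internal hom. -/
def ihomUnit [MonoidalClosed V] : 𝟙_ V ⟶ (ihom (𝟙_ V)).obj (𝟙_ V) :=
  curry (λ_ (𝟙_ V)).hom

/-- For `e : C ⟶ I` and `n : I ⟶ B`, the composite `I ⟶ [I, I] ⟶ [C, B]` of the lax monoidal unit
and `[e, n]`. -/
def convUnit [MonoidalClosed V] {C B : V} (e : C ⟶ 𝟙_ V) (n : 𝟙_ V ⟶ B) :
    𝟙_ V ⟶ (ihom C).obj B :=
  ihomUnit V ≫ (pre e).app (𝟙_ V) ≫ (ihom C).map n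

lemma uncurry_convUnit [MonoidalClosed V] {C B : V} (e : C ⟶ 𝟙_ V) (n : 𝟙_ V ⟶ B) :
    uncurry (convUnit e n) = e ▷ _ ≫ (λ_ _).hom ≫ n := by
  rw [convUnit, ← Category.assoc, uncurry_natural_right, uncurry_pre_app, ihomUnit,
    uncurry_curry, Category.assoc]

lemma convUnit_pre [MonoidalClosed V] {C D B : V} (e : C ⟶ 𝟙_ V) (n : 𝟙_ V ⟶ B) (g : D ⟶ C) :
    convUnit e n ≫ (pre g).app B = convUnit (g ≫ e) n := by
  apply uncurry_injective
  rw [uncurry_pre_app, uncurry_convUnit, uncurry_convUnit]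
  simp

variable [SymmetricCategory V] [MonoidalClosed V]

/-- The lax monoidal structure map `[X, Y] ⊗ [X', Y'] ⟶ [X ⊗ X', Y ⊗ Y']` of the internal hom:
the transpose of
`(X ⊗ X') ⊗ ([X, Y] ⊗ [X', Y']) ≅ (X ⊗ [X, Y]) ⊗ (X' ⊗ [X', Y']) ⟶ Y ⊗ Y'`. -/
def ihomTensor (X X' Y Y' : V) :
    (ihom X).obj Y ⊗ (ihom X').obj Y' ⟶ (ihom (X ⊗ X')).obj (Y ⊗ Y') :=
  curry (tensorμ X X' ((ihom X).obj Y) ((ihom X').obj Y') ≫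
    ((ihom.ev X).app Y ⊗ₘ (ihom.ev X').app Y'))

/-- For `d : Z ⟶ C ⊗ X` and `m : B ⊗ N ⟶ P`, the composite
`[C, B] ⊗ [X, N] ⟶ [C ⊗ X, B ⊗ N] ⟶ [Z, P]` of the lax monoidal structure map and `[d, m]`. -/
def convPair {C X Z B N P : V} (d : Z ⟶ C ⊗ X) (m : B ⊗ N ⟶ P) :
    (ihom C).obj B ⊗ (ihom X).obj N ⟶ (ihom Z).obj P :=
  ihomTensor C X B N ≫ (pre d).app (B ⊗ N) ≫ (ihom Z).map m

lemma uncurry_tensorHom_convPair {C X Z B N P Y Y' : V} (d : Z ⟶ C ⊗ X) (m : B ⊗ N ⟶ P)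
    (f : Y ⟶ (ihom C).obj B) (g : Y' ⟶ (ihom X).obj N) :
    uncurry ((f ⊗ₘ g) ≫ convPair d m) =
      d ▷ _ ≫ tensorμ C X Y Y' ≫ (uncurry f ⊗ₘ uncurry g) ≫ m := by
  rw [convPair, ← Category.assoc, ← Category.assoc, uncurry_natural_right, uncurry_pre_app,
    uncurry_natural_left, ihomTensor, uncurry_curry, tensorμ_natural_right_assoc]
  simp [uncurry_eq]

lemma uncurry_convPair {C X Z B N P : V} (d : Z ⟶ C ⊗ X) (m : B ⊗ N ⟶ P) :
    uncurry (convPair d m) = d ▷ _ ≫ tensorμ C X _ _ ≫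
      ((ihom.ev C).app B ⊗ₘ (ihom.ev X).app N) ≫ m := by
  have h := uncurry_tensorHom_convPair d m (𝟙 _) (𝟙 _)
  rwa [id_tensorHom_id, Category.id_comp, uncurry_id_eq_ev, uncurry_id_eq_ev] at h

lemma convPair_pre {C X Z Z' B N P : V} (d : Z ⟶ C ⊗ X) (m : B ⊗ N ⟶ P) (k : Z' ⟶ Z) :
    convPair d m ≫ (pre k).app P = convPair (k ≫ d) m := by
  apply uncurry_injective
  rw [uncurry_pre_app, uncurry_convPair, uncurry_convPair]
  simp

lemma pre_convPair {C C' X X' Z B N P : V} (d : Z ⟶ C ⊗ X) (m : B ⊗ N ⟶ P)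
    (g : C ⟶ C') (k : X ⟶ X') :
    ((pre g).app B ⊗ₘ (pre k).app N) ≫ convPair d m = convPair (d ≫ (g ⊗ₘ k)) m := by
  apply uncurry_injective
  rw [uncurry_tensorHom_convPair, uncurry_convPair, uncurry_pre, uncurry_pre,
    comp_whiskerRight, Category.assoc, tensorμ_natural_left_assoc]
  simp

lemma convUnit_convPair {C X B N : V} (e : C ⟶ 𝟙_ V) (n : 𝟙_ V ⟶ B) (d : X ⟶ C ⊗ X)
    (m : B ⊗ N ⟶ N) (hd : d ≫ e ▷ X = (λ_ X).inv) (hm : n ▷ N ≫ m = (λ_ N).hom) :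
    convUnit e n ▷ (ihom X).obj N ≫ convPair d m = (λ_ _).hom := by
  apply uncurry_injective
  rw [← tensorHom_id, uncurry_tensorHom_convPair, uncurry_convUnit, uncurry_id_eq_ev, uncurry_eq]
  exact counit_action_aux e n d m _ hd hm

lemma convPair_convUnit {C X B N : V} (e : C ⟶ 𝟙_ V) (n : 𝟙_ V ⟶ B) (d : X ⟶ X ⊗ C)
    (m : N ⊗ B ⟶ N) (hd : d ≫ X ◁ e = (ρ_ X).inv) (hm : N ◁ n ≫ m = (ρ_ N).hom) :
    (ihom X).obj N ◁ convUnit e n ≫ convPair d m = (ρ_ _).hom := by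
  apply uncurry_injective
  rw [← id_tensorHom, uncurry_tensorHom_convPair, uncurry_convUnit, uncurry_id_eq_ev, uncurry_eq]
  exact action_counit_aux e n d m _ hd hm

lemma convPair_assoc {C C' D X Y Z A A' B L M N : V}
    (d : D ⟶ C ⊗ C') (e : Z ⟶ D ⊗ X) (d' : Y ⟶ C' ⊗ X) (e' : Z ⟶ C ⊗ Y)
    (m : A ⊗ A' ⟶ B) (n : B ⊗ L ⟶ N) (m' : A' ⊗ L ⟶ M) (n' : A ⊗ M ⟶ N)
    (hd : e' ≫ C ◁ d' = e ≫ d ▷ X ≫ (α_ C C' X).hom)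
    (hm : m ▷ L ≫ n = (α_ A A' L).hom ≫ A ◁ m' ≫ n') :
    convPair d m ▷ (ihom X).obj L ≫ convPair e n =
      (α_ _ _ _).hom ≫ (ihom C).obj A ◁ convPair d' m' ≫ convPair e' n' := by
  apply uncurry_injective
  rw [← tensorHom_id, ← id_tensorHom, uncurry_tensorHom_convPair, uncurry_natural_left,
    uncurry_tensorHom_convPair, uncurry_id_eq_ev, uncurry_id_eq_ev, uncurry_convPair,
    uncurry_convPair]
  exact assoc_action_aux d e d' e' m n m' n' _ _ _ hd hm

/-- The convolution monoid structure on `[C, B]`, for a comonoid `C` and a monoid `B`: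
the multiplication is `[C, B] ⊗ [C, B] ⟶ [C ⊗ C, B ⊗ B] ⟶ [C, B]` and the unit is
`I ⟶ [I, I] ⟶ [C, B]`. -/
@[reducible]
def convMonObj (C B : V) [ComonObj C] [MonObj B] : MonObj ((ihom C).obj B) where
  one := convUnit ε[C] η[B]
  mul := convPair Δ[C] μ[B]
  one_mul := convUnit_convPair _ _ _ _ (ComonObj.counit_comul C) (MonObj.one_mul B)
  mul_one := convPair_convUnit _ _ _ _ (ComonObj.comul_counit C) (MonObj.mul_one B)
  mul_assoc := convPair_assoc _ _ _ _ _ _ _ _ (ComonObj.comul_assoc C) (MonObj.mul_assoc B)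

/-- The convolution monoid `[C, B]`. -/
@[simps X]
def convMon (C : Comon V) (B : Mon V) : Mon V where
  X := (ihom C.X).obj B.X
  mon := convMonObj C.X B.X

/-- The functor `[-, B] : Comon(V)ᵒᵖ ⥤ Mon(V)` sending a comonoid to the convolution monoid. -/
@[simps obj]
def convMonFunctor (B : Mon V) : (Comon V)ᵒᵖ ⥤ Mon V where
  obj C := convMon C.unop B
  map {C D} g :=
    { hom := (pre g.unop.hom).app B.X
      isMonHom_hom :=
        { one_hom := by
            refine (convUnit_pre _ _ _).trans ?_
            rw [IsComonHom.hom_counit]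
            rfl
          mul_hom := by
            refine (convPair_pre _ _ _).trans (Eq.trans ?_ (pre_convPair _ _ _ _).symm)
            rw [IsComonHom.hom_comul] } }
  map_id C := by
    apply Mon.Hom.ext
    change (pre (𝟙 C.unop.X)).app B.X = 𝟙 _
    simp
  map_comp {C D E} f g := by
    apply Mon.Hom.ext
    change (pre (g.unop.hom ≫ f.unop.hom)).app B.X =
      (pre f.unop.hom).app B.X ≫ (pre g.unop.hom).app B.X
    simp

/-- The `[C, B]`-module `[X, N]`, for a `C`-comodule `X` and a `B`-module `N`: the action is
`[C, B] ⊗ [X, N] ⟶ [C ⊗ X, B ⊗ N] ⟶ [X, N]`. -/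
@[simps mon X]
def convMod (X : ComodTotal V) (N : ModTotal V) : ModTotal V where
  mon := convMon X.comon N.mon
  X := (ihom X.X).obj N.X
  mod :=
    { smul := convPair X.coact N.act
      one_smul := convUnit_convPair _ _ _ _ ComodObj.counit_coact N.one_act
      mul_smul := convPair_assoc _ _ _ _ _ _ _ _ ComodObj.coassoc N.mul_act }

/-- The functor `Hom(-, N_B) : Comodᵒᵖ ⥤ Mod` sending `X_C` to the `[C, B]`-module `[X, N]`. -/
@[simps obj]
def homFunctor (N : ModTotal V) : (ComodTotal V)ᵒᵖ ⥤ ModTotal V where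
  obj X := convMod X.unop N
  map {X Y} k :=
    { base := (convMonFunctor N.mon).map k.unop.base.op
      hom := (pre k.unop.hom).app N.X
      comm := by
        refine (convPair_pre _ _ _).trans (Eq.trans ?_
          ((pre_convPair Y.unop.coact N.act k.unop.base.hom k.unop.hom).symm.trans ?_))
        · rw [k.unop.comm, MonoidalCategory.tensorHom_def]
        · rw [MonoidalCategory.tensorHom_def, Category.assoc]
          rfl }
  map_id X := by
    apply ModTotal.hom_ext
    · exact (convMonFunctor N.mon).map_id _
    · change (pre (𝟙 X.unop.X)).app N.X = 𝟙 _
      simp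
  map_comp {X Y Z} f g := by
    apply ModTotal.hom_ext
    · exact (convMonFunctor N.mon).map_comp f.unop.base.op g.unop.base.op
    · change (pre (g.unop.hom ≫ f.unop.hom)).app N.X =
        (pre f.unop.hom).app N.X ≫ (pre g.unop.hom).app N.X
      simp

end Convolution

section Adjunction

variable {𝒞 : Type u₁} [Category.{v₁} 𝒞] {𝒟 : Type u₂} [Category.{v₂} 𝒟]
  {𝒳 : Type u₃} [Category.{v₃} 𝒳] {𝒴 : Type u₄} [Category.{v₄} 𝒴]

/-- The adjunction `K ⊣ R` lies over the adjunction `F ⊣ G` along the functors `U` and `W`, that is,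
the two form an adjunction in the 2-category of functors and commutative squares: both squares
commute, and the unit and the counit of `K ⊣ R` are sent to those of `F ⊣ G`. -/
structure LiesOver (U : 𝒞 ⥤ 𝒳) (W : 𝒟 ⥤ 𝒴) {K : 𝒞 ⥤ 𝒟} {R : 𝒟 ⥤ 𝒞} (adj : K ⊣ R)
    {F : 𝒳 ⥤ 𝒴} {G : 𝒴 ⥤ 𝒳} (adj' : F ⊣ G) : Prop where
  left_comm : K ⋙ W = U ⋙ F
  right_comm : R ⋙ U = W ⋙ G
  unit_over (X : 𝒞) : U.map (adj.unit.app X) = adj'.unit.app (U.obj X) ≫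
    eqToHom ((congrArg G.obj (Functor.congr_obj left_comm X)).symm.trans
      (Functor.congr_obj right_comm (K.obj X)).symm)
  counit_over (D : 𝒟) : W.map (adj.counit.app D) =
    eqToHom ((Functor.congr_obj left_comm (R.obj D)).trans
      (congrArg F.obj (Functor.congr_obj right_comm D))) ≫ adj'.counit.app (W.obj D)

end Adjunction

end MeasuringComodule

namespace MeasuringComodule

open scoped ComonObj
open Limits

/-! ### Colimits of comodules over varying comonoids -/

section Colimits

variable {V : Type u} [Category.{v} V] [MonoidalCategory V]

/-! The heart of the matter is that `Hom(-, N)` has an adjoint; everything about `P(-, B)` follows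
from that.

Colimits in `Comod` are computed on the two underlying objects, and `[-, Y]` turns colimits of `V`
into limits, so `homFunctor N` preserves limits. By the adjoint functor theorem it remains to find a
small family of comodules of which every comodule is a colimit. Take an uncountable regular `κ` with
`V` locally `κ`-presentable, and the comodules whose comonoid and underlying object are both
`κ`-presentable. That they suffice is a Löwenheim–Skolem argument
(`Approximation.exists_factorization`). Write `C` and `X` as `κ`-filtered colimits of
`κ`-presentable objects. Since `V` is closed, tensor products of these diagrams have colimits `C ⊗
C`, `C ⊗ X` and so on; hence `Δ` and the coaction restrict to maps from each stage to a later one,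
and each axiom holds after going further along. Iterating gives a countable chain whose colimit is
an honest comodule over `X_C`, still `κ`-presentable because `κ` is uncountable. No tensor product
of presentable objects has to be presentable.

The initial object of `V` is a comodule over every comonoid, and `[0, N]` is terminal. So `[-, B]`
is a composite of right adjoints through `homFunctor N` (`isRightAdjoint_convMonFunctor`), and for
any right adjoints `R` and `P` the comonoid of `R M` has the same universal property as `P A`.
Corestricting `R M` along the resulting isomorphism `comparison` puts it over `P A` on the nose, and
the adjunctions then match strictly. -/

/-- The axiom is tested on one leg `x` of a colimit, where the structure map is given by `γ₀` with
values in a possibly later stage and `t` is the transition to that stage. Taking `t = 𝟙` serves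
colimits of comodules, a genuine transition serves chains; `X` may be `C` itself. -/
lemma counit_coact_aux {Z Y' Z' C X : V} {x : Z ⟶ X} {γ : X ⟶ C ⊗ X} {γ₀ : Z ⟶ Y' ⊗ Z'}
    {i : Y' ⟶ C} {k : Z' ⟶ X} (h : x ≫ γ = γ₀ ≫ (i ⊗ₘ k)) {e : C ⟶ 𝟙_ V} {e' : Y' ⟶ 𝟙_ V}
    (he : i ≫ e = e') {t : Z ⟶ Z'} (ht : t ≫ k = x) (h' : γ₀ ≫ e' ▷ Z' = t ≫ (λ_ Z').inv) :
    x ≫ γ ≫ e ▷ X = x ≫ (λ_ X).inv := by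
  subst he
  rw [reassoc_of% h, MonoidalCategory.tensorHom_def', Category.assoc, ← comp_whiskerRight,
    whisker_exchange, reassoc_of% h', ← leftUnitor_inv_naturality, reassoc_of% ht]

lemma coact_counit_aux {Z Y' Z' C X : V} {x : Z ⟶ X} {γ : X ⟶ X ⊗ C} {γ₀ : Z ⟶ Z' ⊗ Y'}
    {i : Y' ⟶ C} {k : Z' ⟶ X} (h : x ≫ γ = γ₀ ≫ (k ⊗ₘ i)) {e : C ⟶ 𝟙_ V} {e' : Y' ⟶ 𝟙_ V}
    (he : i ≫ e = e') {t : Z ⟶ Z'} (ht : t ≫ k = x) (h' : γ₀ ≫ Z' ◁ e' = t ≫ (ρ_ Z').inv) :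
    x ≫ γ ≫ X ◁ e = x ≫ (ρ_ X).inv := by
  subst he
  rw [reassoc_of% h, MonoidalCategory.tensorHom_def, Category.assoc,
    ← MonoidalCategory.whiskerLeft_comp, ← whisker_exchange, reassoc_of% h',
    ← rightUnitor_inv_naturality, reassoc_of% ht]

lemma coassoc_aux {Z Y' Z' Y'' Z'' C X : V} {x : Z ⟶ X} {γ : X ⟶ C ⊗ X} {d : C ⟶ C ⊗ C}
    {γ₀ : Z ⟶ Y' ⊗ Z'} {i : Y' ⟶ C} {k : Z' ⟶ X} (h : x ≫ γ = γ₀ ≫ (i ⊗ₘ k))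
    {γ₁ : Z' ⟶ Y'' ⊗ Z''} {δ₁ : Y' ⟶ Y'' ⊗ Y''} {i' : Y'' ⟶ C} {k' : Z'' ⟶ X}
    (h₁ : k ≫ γ = γ₁ ≫ (i' ⊗ₘ k')) (h₂ : i ≫ d = δ₁ ≫ (i' ⊗ₘ i'))
    {t : Y' ⟶ Y''} (ht : t ≫ i' = i) {t' : Z' ⟶ Z''} (ht' : t' ≫ k' = k)
    (h' : γ₀ ≫ (t ⊗ₘ γ₁) = γ₀ ≫ (δ₁ ⊗ₘ t') ≫ (α_ _ _ _).hom) :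
    x ≫ γ ≫ C ◁ γ = x ≫ γ ≫ d ▷ X ≫ (α_ _ _ _).hom := by
  rw [reassoc_of% h, reassoc_of% h, ← id_tensorHom, ← tensorHom_id, tensorHom_comp_tensorHom,
    tensorHom_comp_tensorHom_assoc, h₁, h₂, Category.comp_id, Category.comp_id, ← ht,
    ← tensorHom_comp_tensorHom, reassoc_of% h', ← ht', ← tensorHom_comp_tensorHom]
  simp

lemma coassoc_of_whisker {C X : V} {γ : X ⟶ C ⊗ X} {d : C ⟶ C ⊗ C}
    (h : γ ≫ C ◁ γ = γ ≫ d ▷ X ≫ (α_ _ _ _).hom) :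
    γ ≫ (𝟙 C ⊗ₘ γ) = γ ≫ (d ⊗ₘ 𝟙 X) ≫ (α_ _ _ _).hom := by
  simpa using h

lemma coact_naturality_aux {C X D Y E Z : V} {γ : X ⟶ C ⊗ X} {γ' : Y ⟶ D ⊗ Y}
    {g : C ⟶ D} {k : X ⟶ Y} (h : k ≫ γ' = γ ≫ (g ⊗ₘ k)) {i : C ⟶ E} {i' : D ⟶ E} {x : X ⟶ Z}
    {x' : Y ⟶ Z} (hi : g ≫ i' = i) (hx : k ≫ x' = x) :
    k ≫ γ' ≫ (i' ⊗ₘ x') = (γ ≫ (i ⊗ₘ x)) ≫ 𝟙 _ := by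
  rw [reassoc_of% h, tensorHom_comp_tensorHom, hi, hx, Category.comp_id]

lemma hom_coact_aux {Z Y' Z' C X D W : V} {x : Z ⟶ X} {γ : X ⟶ C ⊗ X} {γ₀ : Z ⟶ Y' ⊗ Z'}
    {i : Y' ⟶ C} {k : Z' ⟶ X} (h : x ≫ γ = γ₀ ≫ (i ⊗ₘ k)) {γ' : W ⟶ D ⊗ W}
    {d₁ : C ⟶ D} {d₂ : X ⟶ W} {y : Z ⟶ W} {i' : Y' ⟶ D} {k' : Z' ⟶ W}
    (h' : y ≫ γ' = γ₀ ≫ (i' ⊗ₘ k')) (hx : x ≫ d₂ = y) (hi : i ≫ d₁ = i') (hk : k ≫ d₂ = k') :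
    x ≫ d₂ ≫ γ' = x ≫ γ ≫ (d₁ ⊗ₘ d₂) := by
  subst hx hi hk
  rw [reassoc_of% h, tensorHom_comp_tensorHom, ← h', Category.assoc]

lemma ComodTotal.counit_coact (X : ComodTotal V) :
    X.coact ≫ ε[X.comon.X] ▷ X.X = (λ_ X.X).inv :=
  ComodObj.counit_coact

lemma ComodTotal.coassoc (X : ComodTotal V) :
    X.coact ≫ X.comon.X ◁ X.coact =
      X.coact ≫ Δ[X.comon.X] ▷ X.X ≫ (α_ X.comon.X X.comon.X X.X).hom :=
  ComodObj.coassoc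

lemma ComodTotal.Hom.hom_coact {X Y : ComodTotal V} (f : X ⟶ Y) :
    f.hom ≫ Y.coact = X.coact ≫ (f.base.hom ⊗ₘ f.hom) := by
  rw [f.comm, MonoidalCategory.tensorHom_def]

variable (V) in
/-- The functor sending `X_C` to the underlying object of `C`. -/
def ComodTotal.forgetComon : ComodTotal V ⥤ V where
  obj X := X.comon.X
  map f := f.base.hom

variable (V) in
/-- The functor sending `X_C` to the underlying object of `X`. -/
def ComodTotal.forget : ComodTotal V ⥤ V where
  obj X := X.X
  map f := f.hom

/-- A morphism of comodules given by morphisms between the underlying objects. -/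
def ComodTotal.homMk {X Y : ComodTotal V} (g : X.comon.X ⟶ Y.comon.X) (k : X.X ⟶ Y.X)
    (h₁ : g ≫ ε[Y.comon.X] = ε[X.comon.X])
    (h₂ : g ≫ Δ[Y.comon.X] = Δ[X.comon.X] ≫ (g ⊗ₘ g))
    (h₃ : k ≫ Y.coact = X.coact ≫ (g ⊗ₘ k)) : X ⟶ Y where
  base := Comon.Hom.mk' g h₁ h₂
  hom := k
  comm := by rw [h₃, MonoidalCategory.tensorHom_def]

variable {J : Type u₁} [Category.{v₁} J] (K : J ⥤ ComodTotal V)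

namespace ComodTotal

section

variable {K} {c₁ : Cocone (K ⋙ forgetComon V)} (h₁ : IsColimit c₁)
  {c₂ : Cocone (K ⋙ forget V)} (h₂ : IsColimit c₂)

/-- The comultiplication on the colimit of the underlying objects. -/
def colimitComul : c₁.pt ⟶ c₁.pt ⊗ c₁.pt :=
  h₁.desc
    { pt := _
      ι :=
        { app j := Δ[(K.obj j).comon.X] ≫ (c₁.ι.app j ⊗ₘ c₁.ι.app j)
          naturality _ _ f := coact_naturality_aux (IsComonHom.hom_comul (K.map f).base.hom)
            (c₁.w f) (c₁.w f) } }

lemma ι_colimitComul (j : J) :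
    c₁.ι.app j ≫ colimitComul h₁ = Δ[(K.obj j).comon.X] ≫ (c₁.ι.app j ⊗ₘ c₁.ι.app j) :=
  h₁.fac _ j

/-- The counit on the colimit of the underlying objects. -/
def colimitCounit : c₁.pt ⟶ 𝟙_ V :=
  h₁.desc
    { pt := _
      ι :=
        { app j := ε[(K.obj j).comon.X]
          naturality _ _ f := (IsComonHom.hom_counit (K.map f).base.hom).trans
            (Category.comp_id _).symm } }

lemma ι_colimitCounit (j : J) :
    c₁.ι.app j ≫ colimitCounit h₁ = ε[(K.obj j).comon.X] :=
  h₁.fac _ j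

/-- The coaction on the colimit of the underlying objects. -/
def colimitCoact : c₂.pt ⟶ c₁.pt ⊗ c₂.pt :=
  h₂.desc
    { pt := _
      ι :=
        { app j := (K.obj j).coact ≫ (c₁.ι.app j ⊗ₘ c₂.ι.app j)
          naturality _ _ f := coact_naturality_aux (K.map f).hom_coact (c₁.w f) (c₂.w f) } }

lemma ι_colimitCoact (j : J) :
    c₂.ι.app j ≫ colimitCoact (c₁ := c₁) h₂ =
      (K.obj j).coact ≫ (c₁.ι.app j ⊗ₘ c₂.ι.app j) :=
  h₂.fac _ j

/-- The colimit of a diagram of comonoids, constructed on the colimit of the underlying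
objects. -/
@[reducible]
def colimitComonObj : ComonObj c₁.pt where
  comul := colimitComul h₁
  counit := colimitCounit h₁
  counit_comul := h₁.hom_ext fun j =>
    counit_coact_aux (ι_colimitComul h₁ j) (ι_colimitCounit h₁ j) (Category.id_comp _)
      ((ComonObj.counit_comul (K.obj j).comon.X).trans (Category.id_comp _).symm)
  comul_counit := h₁.hom_ext fun j =>
    coact_counit_aux (ι_colimitComul h₁ j) (ι_colimitCounit h₁ j) (Category.id_comp _)
      ((ComonObj.comul_counit (K.obj j).comon.X).trans (Category.id_comp _).symm)
  comul_assoc := h₁.hom_ext fun j =>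
    coassoc_aux (ι_colimitComul h₁ j) (ι_colimitComul h₁ j) (ι_colimitComul h₁ j)
      (Category.id_comp _) (Category.id_comp _) (coassoc_of_whisker (ComonObj.comul_assoc (K.obj j).comon.X))

/-- The colimit of a diagram of comodules, constructed on the colimits of the underlying
objects. -/
def colimitObj : ComodTotal V where
  comon := { X := c₁.pt, comon := colimitComonObj h₁ }
  X := c₂.pt
  comod :=
    letI := colimitComonObj h₁
    { coact := colimitCoact h₂
      counit_coact := h₂.hom_ext fun j =>
        counit_coact_aux (ι_colimitCoact h₂ j) (ι_colimitCounit h₁ j) (Category.id_comp _)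
          ((counit_coact _).trans (Category.id_comp _).symm)
      coassoc := h₂.hom_ext fun j =>
        coassoc_aux (ι_colimitCoact h₂ j) (ι_colimitCoact h₂ j) (ι_colimitComul h₁ j)
          (Category.id_comp _) (Category.id_comp _) (coassoc_of_whisker (coassoc _)) }

/-- The colimit cocone of a diagram of comodules. -/
def colimitCocone : Cocone K where
  pt := colimitObj h₁ h₂
  ι :=
    { app j := homMk (Y := colimitObj h₁ h₂) (c₁.ι.app j) (c₂.ι.app j) (ι_colimitCounit h₁ j)
        (ι_colimitComul h₁ j) (ι_colimitCoact h₂ j)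
      naturality i j f := by
        ext
        · exact c₁.ι.naturality f
        · exact c₂.ι.naturality f }

end

/-- A cocone of comodules is a colimit if the cocones of underlying objects are. -/
def isColimitOfForget {K : J ⥤ ComodTotal V} {c : Cocone K}
    (h₁ : IsColimit ((forgetComon V).mapCocone c)) (h₂ : IsColimit ((forget V).mapCocone c)) :
    IsColimit c where
  desc s := homMk (h₁.desc ((forgetComon V).mapCocone s)) (h₂.desc ((forget V).mapCocone s))
    (h₁.hom_ext fun j =>
      (congrArg (· ≫ ε[s.pt.comon.X]) (h₁.fac ((forgetComon V).mapCocone s) j) |>.symm.trans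
        (Category.assoc _ _ _) |>.symm).trans
        ((IsComonHom.hom_counit (s.ι.app j).base.hom).trans
          (IsComonHom.hom_counit (c.ι.app j).base.hom).symm))
    (h₁.hom_ext fun j => hom_coact_aux (IsComonHom.hom_comul (c.ι.app j).base.hom)
      (IsComonHom.hom_comul (s.ι.app j).base.hom)
      (h₁.fac ((forgetComon V).mapCocone s) j) (h₁.fac ((forgetComon V).mapCocone s) j)
      (h₁.fac ((forgetComon V).mapCocone s) j))
    (h₂.hom_ext fun j => hom_coact_aux (c.ι.app j).hom_coact (s.ι.app j).hom_coact
      (h₂.fac ((forget V).mapCocone s) j) (h₁.fac ((forgetComon V).mapCocone s) j)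
      (h₂.fac ((forget V).mapCocone s) j))
  fac s j := by
    ext
    · exact h₁.fac ((forgetComon V).mapCocone s) j
    · exact h₂.fac ((forget V).mapCocone s) j
  uniq s m hm := by
    ext
    · exact h₁.uniq ((forgetComon V).mapCocone s) m.base.hom fun j =>
        congrArg (fun f => f.base.hom) (hm j)
    · exact h₂.uniq ((forget V).mapCocone s) m.hom fun j => congrArg (fun f => f.hom) (hm j)

section

variable {K} {c₁ : Cocone (K ⋙ forgetComon V)} (h₁ : IsColimit c₁)
  {c₂ : Cocone (K ⋙ forget V)} (h₂ : IsColimit c₂)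

/-- The underlying comonoid of the colimit of comodules is the colimit of the underlying
objects. -/
def isColimitForgetComonColimitCocone :
    IsColimit ((forgetComon V).mapCocone (colimitCocone h₁ h₂)) :=
  h₁.ofIsoColimit (Cocone.ext (Iso.refl _) fun _ => Category.comp_id _)

/-- The underlying object of the colimit of comodules is the colimit of the underlying
objects. -/
def isColimitForgetColimitCocone :
    IsColimit ((forget V).mapCocone (colimitCocone h₁ h₂)) :=
  h₂.ofIsoColimit (Cocone.ext (Iso.refl _) fun _ => Category.comp_id _)

/-- The colimit cocone of a diagram of comodules is a colimit. -/
def isColimitColimitCocone : IsColimit (colimitCocone h₁ h₂) :=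
  isColimitOfForget (isColimitForgetComonColimitCocone h₁ h₂)
    (isColimitForgetColimitCocone h₁ h₂)

end

instance [HasColimitsOfShape J V] : HasColimitsOfShape J (ComodTotal V) where
  has_colimit K := ⟨_, isColimitColimitCocone (K := K) (colimit.isColimit _) (colimit.isColimit _)⟩

instance [HasColimitsOfSize.{v₁, u₁} V] : HasColimitsOfSize.{v₁, u₁} (ComodTotal V) where

instance [HasColimitsOfShape J V] : PreservesColimitsOfShape J (forgetComon V) where
  preservesColimit {K} := preservesColimit_of_preserves_colimit_cocone
    (isColimitColimitCocone (K := K) (colimit.isColimit _) (colimit.isColimit _))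
    (isColimitForgetComonColimitCocone _ _)

instance [HasColimitsOfShape J V] : PreservesColimitsOfShape J (forget V) where
  preservesColimit {K} := preservesColimit_of_preserves_colimit_cocone
    (isColimitColimitCocone (K := K) (colimit.isColimit _) (colimit.isColimit _))
    (isColimitForgetColimitCocone _ _)

end ComodTotal

end Colimits

/-! ### Sequential colimits -/

section SequentialColimit

variable {V : Type u} [Category.{v} V] [HasColimitsOfSize.{v, v} V]
  {Y : ℕ → V} (t : ∀ n, Y n ⟶ Y (n + 1))

/-- The colimit of a sequence of morphisms. -/
noncomputable def seqColim : V := colimit (Functor.ofSequence t)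

/-- The inclusions in the colimit of a sequence of morphisms. -/
noncomputable def seqι (n : ℕ) : Y n ⟶ seqColim t := colimit.ι (Functor.ofSequence t) n

lemma seqι_w (n : ℕ) : t n ≫ seqι t (n + 1) = seqι t n := by
  rw [← Functor.ofSequence_map_homOfLE_succ t n]
  exact colimit.w (Functor.ofSequence t) (homOfLE (Nat.le_add_right n 1))

/-- Morphisms out of the colimit of a sequence of morphisms. -/
noncomputable def seqDesc {A : V} (a : ∀ n, Y n ⟶ A) (w : ∀ n, t n ≫ a (n + 1) = a n) :
    seqColim t ⟶ A :=
  colimit.desc (Functor.ofSequence t)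
    { pt := A
      ι := NatTrans.ofSequence a fun n => by
        rw [Functor.ofSequence_map_homOfLE_succ]
        exact (w n).trans (Category.comp_id _).symm }

lemma seqι_desc {A : V} (a : ∀ n, Y n ⟶ A) (w : ∀ n, t n ≫ a (n + 1) = a n) (n : ℕ) :
    seqι t n ≫ seqDesc t a w = a n :=
  colimit.ι_desc _ _

variable {t} in
lemma seqColim_hom_ext {A : V} {f g : seqColim t ⟶ A} (h : ∀ n, seqι t n ≫ f = seqι t n ≫ g) :
    f = g :=
  colimit.hom_ext h

/-- Uncountability of `κ` enters here: `ℕ` has countably many arrows, so this is a `κ`-small colimit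
of `κ`-presentable objects. -/
lemma isCardinalPresentable_seqColim (κ : Cardinal.{v}) [Fact κ.IsRegular]
    (hκ : Cardinal.aleph0 < κ) [∀ n, IsCardinalPresentable (Y n) κ] :
    IsCardinalPresentable (seqColim t) κ := by
  have (n : ℕ) : IsCardinalPresentable ((Functor.ofSequence t).obj n) κ :=
    inferInstanceAs (IsCardinalPresentable (Y n) κ)
  have h : HasCardinalLT (Arrow ℕ) κ := by
    have : Countable (Arrow ℕ) :=
      Function.Injective.countable (f := fun a : Arrow ℕ => (a.left, a.right)) (by
        rintro ⟨a, b, f⟩ ⟨a', b', f'⟩ h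
        obtain ⟨rfl, rfl⟩ := Prod.mk.inj h
        obtain rfl : f = f' := Subsingleton.elim _ _
        rfl)
    rw [HasCardinalLT, Cardinal.lift_uzero]
    exact (Cardinal.lift_le_aleph0.2 Cardinal.mk_le_aleph0).trans_lt hκ
  exact isCardinalPresentable_of_isColimit _ (colimit.isColimit (Functor.ofSequence t)) κ h

end SequentialColimit

/-! ### Chains of partially defined comodule structures -/

section Chain

variable {V : Type u} [Category.{v} V] [MonoidalCategory V]

/-- A sequence of objects over (the underlying objects of) a comodule, with compatible
comultiplications and coactions, each defined on one stage with values in the next one. -/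
structure ComodChain (T : ComodTotal V) where
  (Y Z : ℕ → V)
  (t : ∀ n, Y n ⟶ Y (n + 1))
  (s : ∀ n, Z n ⟶ Z (n + 1))
  (f : ∀ n, Y n ⟶ T.comon.X)
  (g : ∀ n, Z n ⟶ T.X)
  (δ : ∀ n, Y n ⟶ Y (n + 1) ⊗ Y (n + 1))
  (γ : ∀ n, Z n ⟶ Y (n + 1) ⊗ Z (n + 1))
  t_f (n : ℕ) : t n ≫ f (n + 1) = f n
  s_g (n : ℕ) : s n ≫ g (n + 1) = g n
  δ_f (n : ℕ) : f n ≫ Δ[T.comon.X] = δ n ≫ (f (n + 1) ⊗ₘ f (n + 1))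
  γ_g (n : ℕ) : g n ≫ T.coact = γ n ≫ (f (n + 1) ⊗ₘ g (n + 1))
  δ_counit (n : ℕ) : δ n ≫ (f (n + 1) ≫ ε[T.comon.X]) ▷ _ = t n ≫ (λ_ _).inv
  δ_counit' (n : ℕ) : δ n ≫ _ ◁ (f (n + 1) ≫ ε[T.comon.X]) = t n ≫ (ρ_ _).inv
  γ_counit (n : ℕ) : γ n ≫ (f (n + 1) ≫ ε[T.comon.X]) ▷ _ = s n ≫ (λ_ _).inv
  δ_comm (n : ℕ) : t n ≫ δ (n + 1) = δ n ≫ (t (n + 1) ⊗ₘ t (n + 1))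
  γ_comm (n : ℕ) : s n ≫ γ (n + 1) = γ n ≫ (t (n + 1) ⊗ₘ s (n + 1))
  δ_coassoc (n : ℕ) : δ n ≫ (t (n + 1) ⊗ₘ δ (n + 1)) =
    δ n ≫ (δ (n + 1) ⊗ₘ t (n + 1)) ≫ (α_ _ _ _).hom
  γ_coassoc (n : ℕ) : γ n ≫ (t (n + 1) ⊗ₘ γ (n + 1)) =
    γ n ≫ (δ (n + 1) ⊗ₘ s (n + 1)) ≫ (α_ _ _ _).hom

namespace ComodChain

variable [HasColimitsOfSize.{v, v} V] {T : ComodTotal V} (c : ComodChain T)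

/-- The comultiplication on the colimit of a chain. -/
noncomputable def comul : seqColim c.t ⟶ seqColim c.t ⊗ seqColim c.t :=
  seqDesc c.t (fun n => c.δ n ≫ (seqι c.t (n + 1) ⊗ₘ seqι c.t (n + 1))) fun n => by
    rw [reassoc_of% c.δ_comm, tensorHom_comp_tensorHom, seqι_w]

/-- The coaction on the colimit of a chain. -/
noncomputable def coact : seqColim c.s ⟶ seqColim c.t ⊗ seqColim c.s :=
  seqDesc c.s (fun n => c.γ n ≫ (seqι c.t (n + 1) ⊗ₘ seqι c.s (n + 1))) fun n => by
    rw [reassoc_of% c.γ_comm, tensorHom_comp_tensorHom, seqι_w, seqι_w]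

/-- The map from the colimit of a chain to the underlying object of the comonoid. -/
noncomputable def toComon : seqColim c.t ⟶ T.comon.X := seqDesc c.t c.f c.t_f

lemma ι_comul (n : ℕ) :
    seqι c.t n ≫ c.comul = c.δ n ≫ (seqι c.t (n + 1) ⊗ₘ seqι c.t (n + 1)) :=
  seqι_desc _ _ _ _

lemma ι_coact (n : ℕ) :
    seqι c.s n ≫ c.coact = c.γ n ≫ (seqι c.t (n + 1) ⊗ₘ seqι c.s (n + 1)) :=
  seqι_desc _ _ _ _

lemma ι_toComon (n : ℕ) : seqι c.t n ≫ c.toComon = c.f n :=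
  seqι_desc _ _ _ _

/-- The counit has the fixed target `I`, so unlike the comultiplication it is simply restricted from
`T` and never lifted through stages. -/
lemma ι_counit (n : ℕ) : seqι c.t n ≫ c.toComon ≫ ε[T.comon.X] = c.f n ≫ ε[T.comon.X] := by
  rw [reassoc_of% c.ι_toComon]

/-- The comonoid structure on the colimit of a chain. -/
@[reducible]
noncomputable def comonObj : ComonObj (seqColim c.t) where
  comul := c.comul
  counit := c.toComon ≫ ε[T.comon.X]
  counit_comul := seqColim_hom_ext fun n =>
    counit_coact_aux (c.ι_comul n) (c.ι_counit _) (seqι_w _ _) (c.δ_counit n)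
  comul_counit := seqColim_hom_ext fun n =>
    coact_counit_aux (c.ι_comul n) (c.ι_counit _) (seqι_w _ _) (c.δ_counit' n)
  comul_assoc := seqColim_hom_ext fun n =>
    coassoc_aux (c.ι_comul n) (c.ι_comul _) (c.ι_comul _) (seqι_w _ _) (seqι_w _ _)
      (c.δ_coassoc n)

/-- The colimit of a chain. -/
noncomputable def colim : ComodTotal V where
  comon := { X := seqColim c.t, comon := c.comonObj }
  X := seqColim c.s
  comod :=
    letI := c.comonObj
    { coact := c.coact
      counit_coact := seqColim_hom_ext fun n =>
        counit_coact_aux (c.ι_coact n) (c.ι_counit _) (seqι_w _ _) (c.γ_counit n)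
      coassoc := seqColim_hom_ext fun n =>
        coassoc_aux (c.ι_coact n) (c.ι_coact _) (c.ι_comul _) (seqι_w _ _) (seqι_w _ _)
          (c.γ_coassoc n) }

/-- The map from the colimit of a chain. -/
noncomputable def toTotal : c.colim ⟶ T :=
  ComodTotal.homMk (X := c.colim) c.toComon (seqDesc c.s c.g c.s_g) rfl
    (seqColim_hom_ext fun n => hom_coact_aux (c.ι_comul n) (c.δ_f n) (c.ι_toComon _)
      (c.ι_toComon _) (c.ι_toComon _))
    (seqColim_hom_ext fun n => hom_coact_aux (c.ι_coact n) (c.γ_g n) (seqι_desc _ _ _ _)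
      (c.ι_toComon _) (seqι_desc _ _ _ _))

/-- A morphism to the colimit of a chain which factors through the initial stage. -/
noncomputable def ofInitial {E : ComodTotal V} (p : E ⟶ T) (e : E.comon.X ⟶ c.Y 0)
    (e' : E.X ⟶ c.Z 0) (he : e ≫ c.f 0 = p.base.hom)
    (hδ : e ≫ c.δ 0 = Δ[E.comon.X] ≫ (e ≫ c.t 0 ⊗ₘ e ≫ c.t 0))
    (hγ : e' ≫ c.γ 0 = E.coact ≫ (e ≫ c.t 0 ⊗ₘ e' ≫ c.s 0)) : E ⟶ c.colim :=
  ComodTotal.homMk (Y := c.colim) (e ≫ seqι c.t 0) (e' ≫ seqι c.s 0)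
    (by
      refine (Category.assoc _ _ _).trans ?_
      change e ≫ seqι c.t 0 ≫ c.toComon ≫ ε[T.comon.X] = _
      rw [c.ι_counit, reassoc_of% he, IsComonHom.hom_counit])
    (by
      refine (Category.assoc _ _ _).trans ?_
      change e ≫ seqι c.t 0 ≫ c.comul = _
      rw [c.ι_comul, reassoc_of% hδ, tensorHom_comp_tensorHom, Category.assoc, seqι_w]
      rfl)
    (by
      refine (Category.assoc _ _ _).trans ?_
      change e' ≫ seqι c.s 0 ≫ c.coact = _
      rw [c.ι_coact, reassoc_of% hγ, tensorHom_comp_tensorHom, Category.assoc, seqι_w,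
        Category.assoc, seqι_w]
      rfl)

end ComodChain

end Chain

/-! ### Properties that hold eventually in a filtered category -/

section Eventually

variable {J : Type u₁} [Category.{v₁} J]

/-- A property of morphisms out of `i` holds eventually if it holds for all morphisms which factor
through some fixed morphism. -/
def Eventually (i : J) (Q : ∀ ⦃l : J⦄, (i ⟶ l) → Prop) : Prop :=
  ∃ (k : J) (u : i ⟶ k), ∀ ⦃l : J⦄ (w : k ⟶ l), Q (u ≫ w)

/-- Quantifying over all later `w` makes the property persist, so finitely many equations can be met
at a single stage. -/
lemma Eventually.and [IsFiltered J] {i : J} {Q Q' : ∀ ⦃l : J⦄, (i ⟶ l) → Prop}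
    (h : Eventually i Q) (h' : Eventually i Q') : Eventually i fun _ w => Q w ∧ Q' w := by
  obtain ⟨k, u, hu⟩ := h
  obtain ⟨k', u', hu'⟩ := h'
  obtain ⟨m, a, b, hab⟩ := IsFiltered.span u u'
  refine ⟨m, u ≫ a, fun l w => ⟨?_, ?_⟩⟩
  · rw [Category.assoc]
    exact hu _
  · rw [hab, Category.assoc]
    exact hu' _

lemma Eventually.exists {i : J} {Q : ∀ ⦃l : J⦄, (i ⟶ l) → Prop} (h : Eventually i Q) :
    ∃ (k : J) (u : i ⟶ k), Q u := by
  obtain ⟨k, u, hu⟩ := h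
  exact ⟨k, u, by simpa using hu (𝟙 k)⟩

end Eventually

/-! ### Tensor products of filtered colimits -/

section Tensor

variable {V : Type u} [Category.{v} V] [MonoidalCategory V] {J : Type u₁} [Category.{v₁} J]

/-- The pointwise tensor product of two diagrams. -/
def tensorDiag (F G : J ⥤ V) : J ⥤ V where
  obj j := F.obj j ⊗ G.obj j
  map w := F.map w ⊗ₘ G.map w

/-- The pointwise tensor product of two cocones. -/
def tensorCocone {F G : J ⥤ V} (c : Cocone F) (d : Cocone G) : Cocone (tensorDiag F G) where
  pt := c.pt ⊗ d.pt
  ι := { app j := c.ι.app j ⊗ₘ d.ι.app j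
         naturality _ _ w :=
           (tensorHom_comp_tensorHom _ _ _ _).trans ((congrArg₂ _ (c.w w) (d.w w)).trans
             (Category.comp_id _).symm) }

/-- Closedness makes `⊗` preserve colimits in each variable, which gives a colimit over `J × J`; the
diagonal of a filtered category is final. -/
lemma nonempty_isColimit_tensorCocone [SymmetricCategory V] [MonoidalClosed V] [IsFiltered J]
    {F G : J ⥤ V} {c : Cocone F} {d : Cocone G} (hc : IsColimit c) (hd : IsColimit d) :
    Nonempty (IsColimit (tensorCocone c d)) := by
  have (x : V) : PreservesColimit F ((curriedTensor V).flip.obj x) :=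
    inferInstanceAs (PreservesColimit F (tensorRight x))
  have (x : V) : PreservesColimit G ((curriedTensor V).obj x) :=
    inferInstanceAs (PreservesColimit G (tensorLeft x))
  have h := isColimitOfPreserves₂ (curriedTensor V) hc hd
  have h' := (Functor.Final.isColimitWhiskerEquiv (Functor.diag J) _).symm h
  have w {i j : J} (a : i ⟶ j) :
      (Functor.diag J ⋙ Functor.uncurry.obj
        ((((Functor.whiskeringLeft₂ V).obj F).obj G).obj (curriedTensor V))).map a =
        (tensorDiag F G).map a :=
    (MonoidalCategory.tensorHom_def _ _).symm
  have e (j : J) : (((curriedTensor V).mapCocone₂ c d).whisker (Functor.diag J)).ι.app j =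
      (tensorCocone c d).ι.app j :=
    (MonoidalCategory.tensorHom_def _ _).symm
  -- The restricted bifunctor acts by composites of whiskerings, which equal `⊗ₘ` only up to a
  -- proof, so cocones are converted by hand.
  let φ (s : Cocone (tensorDiag F G)) : Cocone (Functor.diag J ⋙ Functor.uncurry.obj
        ((((Functor.whiskeringLeft₂ V).obj F).obj G).obj (curriedTensor V))) :=
    { pt := s.pt
      ι :=
        { app j := s.ι.app j
          naturality i j a := (congrArg (· ≫ s.ι.app j) (w a)).trans (s.ι.naturality a) } }
  exact ⟨
    { desc s := h'.desc (φ s)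
      fac s j := (congrArg (· ≫ h'.desc (φ s)) (e j)).symm.trans (h'.fac (φ s) j)
      uniq s m hm := h'.uniq (φ s) m fun j => (congrArg (· ≫ m) (e j)).trans (hm j) }⟩

omit [MonoidalCategory V] in
lemma eventually_eq {κ : Cardinal.{v}} [Fact κ.IsRegular] [EssentiallySmall.{v} J]
    [IsCardinalFiltered J κ] {F : J ⥤ V} {c : Cocone F} {Z : V} [IsCardinalPresentable Z κ] (hc : IsColimit c) {j : J}
    (a b : Z ⟶ F.obj j) (h : a ≫ c.ι.app j = b ≫ c.ι.app j) :
    Eventually j fun _ w => a ≫ F.map w = b ≫ F.map w := by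
  obtain ⟨k, u, hu⟩ := IsCardinalPresentable.exists_eq_of_isColimit' κ hc a b h
  exact ⟨k, u, fun l w => by simp only [F.map_comp, reassoc_of% hu]⟩

omit [MonoidalCategory V] in
lemma exists_lift {κ : Cardinal.{v}} [Fact κ.IsRegular] [EssentiallySmall.{v} J]
    [IsCardinalFiltered J κ] {F : J ⥤ V} {c : Cocone F} {Z : V} [IsCardinalPresentable Z κ]
    (hc : IsColimit c) (i : J) (a : Z ⟶ c.pt) :
    ∃ (j : J) (_ : i ⟶ j) (b : Z ⟶ F.obj j), b ≫ c.ι.app j = a := by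
  have := isFiltered_of_isCardinalFiltered J κ
  obtain ⟨j, b, hb⟩ := IsCardinalPresentable.exists_hom_of_isColimit κ hc a
  exact ⟨IsFiltered.max i j, IsFiltered.leftToMax i j, b ≫ F.map (IsFiltered.rightToMax i j),
    by rw [Category.assoc, c.w, hb]⟩

/-- The cocone given by compatible morphisms. -/
def coconeMk {F : J ⥤ V} {A : V} (f : ∀ j, F.obj j ⟶ A)
    (w : ∀ {i j : J} (a : i ⟶ j), F.map a ≫ f j = f i) : Cocone F where
  pt := A
  ι := { app := f
         naturality _ _ a := (w a).trans (Category.comp_id _).symm }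

end Tensor

/-! ### Equations valid in the colimit, and their consequences at later stages -/

section

variable {V : Type u} [Category.{v} V] [MonoidalCategory V]

/-- The `_lift` lemmas show that an axiom of `T` holds for lifted structure maps after passing to
the colimit. Presentability then yields it at a later stage, and the `_push` lemmas rewrite it as
the axiom for the structure maps pushed to that stage. -/
lemma counit_coact_lift {Z Y' Z' C X : V} {x : Z ⟶ X} {γ : X ⟶ C ⊗ X} {γ₀ : Z ⟶ Y' ⊗ Z'}
    {i : Y' ⟶ C} {k : Z' ⟶ X} (h : x ≫ γ = γ₀ ≫ (i ⊗ₘ k)) {e : C ⟶ 𝟙_ V}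
    (he : γ ≫ e ▷ X = (λ_ X).inv) : (γ₀ ≫ (i ≫ e) ▷ Z' ≫ (λ_ Z').hom) ≫ k = x := by
  have h' := h =≫ (e ▷ X ≫ (λ_ X).hom)
  rw [Category.assoc, reassoc_of% he, Iso.inv_hom_id, Category.comp_id] at h'
  rw [h']
  simp [MonoidalCategory.tensorHom_def, whisker_exchange_assoc]

lemma coact_counit_lift {Z Y' Z' C X : V} {x : Z ⟶ X} {γ : X ⟶ X ⊗ C} {γ₀ : Z ⟶ Z' ⊗ Y'}
    {i : Y' ⟶ C} {k : Z' ⟶ X} (h : x ≫ γ = γ₀ ≫ (k ⊗ₘ i)) {e : C ⟶ 𝟙_ V}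
    (he : γ ≫ X ◁ e = (ρ_ X).inv) : (γ₀ ≫ Z' ◁ (i ≫ e) ≫ (ρ_ Z').hom) ≫ k = x := by
  have h' := h =≫ (X ◁ e ≫ (ρ_ X).hom)
  rw [Category.assoc, reassoc_of% he, Iso.inv_hom_id, Category.comp_id] at h'
  rw [h']
  simp [MonoidalCategory.tensorHom_def', ← whisker_exchange_assoc]

lemma counit_coact_push {Z Y Y' Z' W : V} {γ₀ : Z ⟶ Y ⊗ Z'} {a : Y ⟶ Y'} {w : Z' ⟶ W}
    {e : Y ⟶ 𝟙_ V} {e' : Y' ⟶ 𝟙_ V} (he : a ≫ e' = e) {s : Z ⟶ W}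
    (h : (γ₀ ≫ e ▷ Z' ≫ (λ_ Z').hom) ≫ w = s) :
    (γ₀ ≫ (a ⊗ₘ w)) ≫ e' ▷ W = s ≫ (λ_ W).inv := by
  subst h he
  rw [Category.assoc, MonoidalCategory.tensorHom_def', Category.assoc, ← comp_whiskerRight,
    whisker_exchange, ← cancel_mono (λ_ W).hom]
  simp

lemma coact_counit_push {Z Y Y' Z' W : V} {γ₀ : Z ⟶ Z' ⊗ Y} {a : Y ⟶ Y'} {w : Z' ⟶ W}
    {e : Y ⟶ 𝟙_ V} {e' : Y' ⟶ 𝟙_ V} (he : a ≫ e' = e) {s : Z ⟶ W}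
    (h : (γ₀ ≫ Z' ◁ e ≫ (ρ_ Z').hom) ≫ w = s) :
    (γ₀ ≫ (w ⊗ₘ a)) ≫ W ◁ e' = s ≫ (ρ_ W).inv := by
  subst h he
  rw [Category.assoc, MonoidalCategory.tensorHom_def, Category.assoc,
    ← MonoidalCategory.whiskerLeft_comp, ← whisker_exchange, ← cancel_mono (ρ_ W).hom]
  simp

lemma coassoc_lift {Z Y' Z' Y'' Z'' C X : V} {x : Z ⟶ X} {γ : X ⟶ C ⊗ X} {d : C ⟶ C ⊗ C}
    {γ₀ : Z ⟶ Y' ⊗ Z'} {i : Y' ⟶ C} {k : Z' ⟶ X} (h : x ≫ γ = γ₀ ≫ (i ⊗ₘ k))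
    {γ₁ : Z' ⟶ Y'' ⊗ Z''} {δ₁ : Y' ⟶ Y'' ⊗ Y''} {i' : Y'' ⟶ C} {k' : Z'' ⟶ X}
    (h₁ : k ≫ γ = γ₁ ≫ (i' ⊗ₘ k')) (h₂ : i ≫ d = δ₁ ≫ (i' ⊗ₘ i'))
    {t : Y' ⟶ Y''} (ht : t ≫ i' = i) {t' : Z' ⟶ Z''} (ht' : t' ≫ k' = k)
    (hγ : γ ≫ C ◁ γ = γ ≫ d ▷ X ≫ (α_ _ _ _).hom) :
    (γ₀ ≫ (t ⊗ₘ γ₁)) ≫ (i' ⊗ₘ i' ⊗ₘ k') =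
      (γ₀ ≫ (δ₁ ⊗ₘ t') ≫ (α_ _ _ _).hom) ≫ (i' ⊗ₘ i' ⊗ₘ k') := by
  rw [Category.assoc, Category.assoc, Category.assoc, ← associator_naturality,
    tensorHom_comp_tensorHom, tensorHom_comp_tensorHom_assoc, ht, ht', ← h₁, ← h₂]
  have h₃ := x ≫= hγ
  rw [reassoc_of% h, reassoc_of% h] at h₃
  simpa only [← id_tensorHom, ← tensorHom_id, tensorHom_comp_tensorHom,
    tensorHom_comp_tensorHom_assoc, Category.comp_id] using h₃

lemma coassoc_push {Z Y' Z' Y'' Z'' A B C : V} {γ₀ : Z ⟶ Y' ⊗ Z'}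
    {γ₁ : Z' ⟶ Y'' ⊗ Z''} {δ₁ : Y' ⟶ Y'' ⊗ Y''} {t : Y' ⟶ Y''} {t' : Z' ⟶ Z''}
    {a : Y'' ⟶ A} {b : Y'' ⟶ B} {c : Z'' ⟶ C}
    (h : (γ₀ ≫ (t ⊗ₘ γ₁)) ≫ (a ⊗ₘ b ⊗ₘ c) =
      (γ₀ ≫ (δ₁ ⊗ₘ t') ≫ (α_ _ _ _).hom) ≫ (a ⊗ₘ b ⊗ₘ c)) :
    γ₀ ≫ (t ≫ a ⊗ₘ γ₁ ≫ (b ⊗ₘ c)) =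
      γ₀ ≫ (δ₁ ≫ (a ⊗ₘ b) ⊗ₘ t' ≫ c) ≫ (α_ _ _ _).hom := by
  rw [Category.assoc, Category.assoc, Category.assoc, ← associator_naturality,
    tensorHom_comp_tensorHom, tensorHom_comp_tensorHom_assoc] at h
  exact h

end

/-! ### Approximating a comodule by presentable objects -/

section Approximation

variable {V : Type u} [Category.{v} V] [MonoidalCategory V]

/-- Diagrams of shape `J` with colimits the underlying objects of a comodule `X_C`. -/
structure Approximation (T : ComodTotal V) (J : Type u₁) [Category.{v₁} J] where
  (F G : J ⥤ V)
  (f : ∀ j, F.obj j ⟶ T.comon.X)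
  (g : ∀ j, G.obj j ⟶ T.X)
  f_w {i j : J} (a : i ⟶ j) : F.map a ≫ f j = f i
  g_w {i j : J} (a : i ⟶ j) : G.map a ≫ g j = g i
  isColimitF : IsColimit (coconeMk f f_w)
  isColimitG : IsColimit (coconeMk g g_w)

namespace Approximation

attribute [simp] f_w g_w

variable {T : ComodTotal V} {J : Type u₁} [Category.{v₁} J] (A : Approximation T J)

@[simp]
lemma f_w_assoc {i j : J} (a : i ⟶ j) {Z : V} (h : T.comon.X ⟶ Z) :
    A.F.map a ≫ A.f j ≫ h = A.f i ≫ h := by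
  rw [← Category.assoc, f_w]

@[simp]
lemma g_w_assoc {i j : J} (a : i ⟶ j) {Z : V} (h : T.X ⟶ Z) :
    A.G.map a ≫ A.g j ≫ h = A.g i ≫ h := by
  rw [← Category.assoc, g_w]

/-- A comultiplication and a coaction, defined on one stage of an approximation with values in
another one. -/
structure Link (i j : J) where
  u : i ⟶ j
  δ : A.F.obj i ⟶ A.F.obj j ⊗ A.F.obj j
  γ : A.G.obj i ⟶ A.F.obj j ⊗ A.G.obj j
  δ_f : A.f i ≫ Δ[T.comon.X] = δ ≫ (A.f j ⊗ₘ A.f j)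
  γ_g : A.g i ≫ T.coact = γ ≫ (A.f j ⊗ₘ A.g j)
  δ_counit : δ ≫ (A.f j ≫ ε[T.comon.X]) ▷ _ = A.F.map u ≫ (λ_ _).inv
  δ_counit' : δ ≫ _ ◁ (A.f j ≫ ε[T.comon.X]) = A.F.map u ≫ (ρ_ _).inv
  γ_counit : γ ≫ (A.f j ≫ ε[T.comon.X]) ▷ _ = A.G.map u ≫ (λ_ _).inv

/-- A link with arbitrary source and target. -/
structure Stage where
  {src tgt : J}
  link : A.Link src tgt

variable {A} in
/-- The compatibility between consecutive links. -/
structure Link.Compatible {i j k : J} (l : A.Link i j) (m : A.Link j k) : Prop where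
  δ_comm : A.F.map l.u ≫ m.δ = l.δ ≫ (A.F.map m.u ⊗ₘ A.F.map m.u)
  γ_comm : A.G.map l.u ≫ m.γ = l.γ ≫ (A.F.map m.u ⊗ₘ A.G.map m.u)
  δ_coassoc : l.δ ≫ (A.F.map m.u ⊗ₘ m.δ) = l.δ ≫ (m.δ ⊗ₘ A.F.map m.u) ≫ (α_ _ _ _).hom
  γ_coassoc : l.γ ≫ (A.F.map m.u ⊗ₘ m.γ) = l.γ ≫ (m.δ ⊗ₘ A.G.map m.u) ≫ (α_ _ _ _).hom

variable {A} in
/-- Composition of a link with a morphism. -/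
@[simps]
def Link.push {i j k : J} (l : A.Link i j) (w : j ⟶ k) : A.Link i k where
  u := l.u ≫ w
  δ := l.δ ≫ (A.F.map w ⊗ₘ A.F.map w)
  γ := l.γ ≫ (A.F.map w ⊗ₘ A.G.map w)
  δ_f := by simp [l.δ_f]
  γ_g := by simp [l.γ_g]
  δ_counit := counit_coact_push (A.f_w_assoc w _) (by
    rw [reassoc_of% l.δ_counit, Iso.inv_hom_id, Category.comp_id, Functor.map_comp])
  δ_counit' := coact_counit_push (A.f_w_assoc w _) (by
    rw [reassoc_of% l.δ_counit', Iso.inv_hom_id, Category.comp_id, Functor.map_comp])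
  γ_counit := counit_coact_push (A.f_w_assoc w _) (by
    rw [reassoc_of% l.γ_counit, Iso.inv_hom_id, Category.comp_id, Functor.map_comp])

section

variable [SymmetricCategory V] [MonoidalClosed V] (κ : Cardinal.{v}) [Fact κ.IsRegular]
  [EssentiallySmall.{v} J] [IsCardinalFiltered J κ]

include κ

section

variable {Z : V} [IsCardinalPresentable Z κ] {i : J}

omit [SymmetricCategory V] [MonoidalClosed V] in
lemma eventually_eq_f (a b : Z ⟶ A.F.obj i) (h : a ≫ A.f i = b ≫ A.f i) :
    Eventually i fun _ w => a ≫ A.F.map w = b ≫ A.F.map w :=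
  eventually_eq (κ := κ) A.isColimitF a b h

omit [SymmetricCategory V] [MonoidalClosed V] in
lemma eventually_eq_g (a b : Z ⟶ A.G.obj i) (h : a ≫ A.g i = b ≫ A.g i) :
    Eventually i fun _ w => a ≫ A.G.map w = b ≫ A.G.map w :=
  eventually_eq (κ := κ) A.isColimitG a b h

lemma eventually_eq_ff (a b : Z ⟶ A.F.obj i ⊗ A.F.obj i)
    (h : a ≫ (A.f i ⊗ₘ A.f i) = b ≫ (A.f i ⊗ₘ A.f i)) :
    Eventually i fun _ w => a ≫ (A.F.map w ⊗ₘ A.F.map w) = b ≫ (A.F.map w ⊗ₘ A.F.map w) := by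
  have := isFiltered_of_isCardinalFiltered J κ
  obtain ⟨hc⟩ := nonempty_isColimit_tensorCocone A.isColimitF A.isColimitF
  exact eventually_eq (κ := κ) hc a b h

lemma eventually_eq_fg (a b : Z ⟶ A.F.obj i ⊗ A.G.obj i)
    (h : a ≫ (A.f i ⊗ₘ A.g i) = b ≫ (A.f i ⊗ₘ A.g i)) :
    Eventually i fun _ w => a ≫ (A.F.map w ⊗ₘ A.G.map w) = b ≫ (A.F.map w ⊗ₘ A.G.map w) := by
  have := isFiltered_of_isCardinalFiltered J κ
  obtain ⟨hc⟩ := nonempty_isColimit_tensorCocone A.isColimitF A.isColimitG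
  exact eventually_eq (κ := κ) hc a b h

lemma eventually_eq_fff (a b : Z ⟶ A.F.obj i ⊗ A.F.obj i ⊗ A.F.obj i)
    (h : a ≫ (A.f i ⊗ₘ A.f i ⊗ₘ A.f i) = b ≫ (A.f i ⊗ₘ A.f i ⊗ₘ A.f i)) :
    Eventually i fun _ w => a ≫ (A.F.map w ⊗ₘ A.F.map w ⊗ₘ A.F.map w) =
      b ≫ (A.F.map w ⊗ₘ A.F.map w ⊗ₘ A.F.map w) := by
  have := isFiltered_of_isCardinalFiltered J κ
  obtain ⟨hc⟩ := nonempty_isColimit_tensorCocone A.isColimitF A.isColimitF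
  obtain ⟨hc'⟩ := nonempty_isColimit_tensorCocone A.isColimitF hc
  exact eventually_eq (κ := κ) hc' a b h

lemma eventually_eq_ffg (a b : Z ⟶ A.F.obj i ⊗ A.F.obj i ⊗ A.G.obj i)
    (h : a ≫ (A.f i ⊗ₘ A.f i ⊗ₘ A.g i) = b ≫ (A.f i ⊗ₘ A.f i ⊗ₘ A.g i)) :
    Eventually i fun _ w => a ≫ (A.F.map w ⊗ₘ A.F.map w ⊗ₘ A.G.map w) =
      b ≫ (A.F.map w ⊗ₘ A.F.map w ⊗ₘ A.G.map w) := by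
  have := isFiltered_of_isCardinalFiltered J κ
  obtain ⟨hc⟩ := nonempty_isColimit_tensorCocone A.isColimitF A.isColimitG
  obtain ⟨hc'⟩ := nonempty_isColimit_tensorCocone A.isColimitF hc
  exact eventually_eq (κ := κ) hc' a b h

lemma exists_lift_ff (i : J) (a : Z ⟶ T.comon.X ⊗ T.comon.X) :
    ∃ (j : J) (_ : i ⟶ j) (b : Z ⟶ A.F.obj j ⊗ A.F.obj j), b ≫ (A.f j ⊗ₘ A.f j) = a := by
  have := isFiltered_of_isCardinalFiltered J κ
  obtain ⟨hc⟩ := nonempty_isColimit_tensorCocone A.isColimitF A.isColimitF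
  exact exists_lift (κ := κ) hc i a

lemma exists_lift_fg (i : J) (a : Z ⟶ T.comon.X ⊗ T.X) :
    ∃ (j : J) (_ : i ⟶ j) (b : Z ⟶ A.F.obj j ⊗ A.G.obj j), b ≫ (A.f j ⊗ₘ A.g j) = a := by
  have := isFiltered_of_isCardinalFiltered J κ
  obtain ⟨hc⟩ := nonempty_isColimit_tensorCocone A.isColimitF A.isColimitG
  exact exists_lift (κ := κ) hc i a

end

variable [∀ j, IsCardinalPresentable (A.F.obj j) κ] [∀ j, IsCardinalPresentable (A.G.obj j) κ]

/-- Presentability of stage `i` lifts `Δ` and the coaction through the tensor diagrams. The counit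
laws hold in `T`, hence after one more transition `w`. -/
lemma nonempty_link (i : J) : ∃ j, Nonempty (A.Link i j) := by
  have := isFiltered_of_isCardinalFiltered J κ
  obtain ⟨j₁, u₁, δ, hδ⟩ := A.exists_lift_ff κ i (A.f i ≫ Δ[T.comon.X])
  obtain ⟨j, u₂, γ, hγ⟩ := A.exists_lift_fg κ j₁ (A.g i ≫ T.coact)
  replace hδ : (δ ≫ (A.F.map u₂ ⊗ₘ A.F.map u₂)) ≫ (A.f j ⊗ₘ A.f j) = A.f i ≫ Δ[T.comon.X] := by
    simp [hδ]
  generalize δ ≫ (A.F.map u₂ ⊗ₘ A.F.map u₂) = δ at hδ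
  obtain ⟨k, w, ⟨h₁, h₂⟩, h₃⟩ := (((A.eventually_eq_f κ
    (δ ≫ (A.f j ≫ ε[T.comon.X]) ▷ _ ≫ (λ_ _).hom) (A.F.map (u₁ ≫ u₂))
      ((counit_coact_lift hδ.symm (ComonObj.counit_comul _)).trans (A.f_w _).symm)).and
    (A.eventually_eq_f κ
      (δ ≫ _ ◁ (A.f j ≫ ε[T.comon.X]) ≫ (ρ_ _).hom) (A.F.map (u₁ ≫ u₂))
      ((coact_counit_lift hδ.symm (ComonObj.comul_counit _)).trans (A.f_w _).symm))).and
    (A.eventually_eq_g κ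
      (γ ≫ (A.f j ≫ ε[T.comon.X]) ▷ _ ≫ (λ_ _).hom) (A.G.map (u₁ ≫ u₂))
      ((counit_coact_lift hγ.symm T.counit_coact).trans (A.g_w _).symm))).exists
  exact ⟨k, ⟨{
    u := (u₁ ≫ u₂) ≫ w
    δ := δ ≫ (A.F.map w ⊗ₘ A.F.map w)
    γ := γ ≫ (A.F.map w ⊗ₘ A.G.map w)
    δ_f := by simp [hδ]
    γ_g := by simp [hγ]
    δ_counit := counit_coact_push (A.f_w_assoc w _) (h₁.trans (A.F.map_comp _ _).symm)
    δ_counit' := coact_counit_push (A.f_w_assoc w _) (h₂.trans (A.F.map_comp _ _).symm)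
    γ_counit := counit_coact_push (A.f_w_assoc w _) (h₃.trans (A.G.map_comp _ _).symm) }⟩⟩

/-- All four equations start at stage `i` and hold after mapping to `T`. Since `l` stays fixed and
only `m` is pushed further, the construction can be iterated. -/
lemma exists_compatible_link {i j : J} (l : A.Link i j) :
    ∃ (k : J) (m : A.Link j k), l.Compatible m := by
  have := isFiltered_of_isCardinalFiltered J κ
  obtain ⟨k, ⟨m⟩⟩ := A.nonempty_link κ j
  obtain ⟨k', w, ⟨⟨h₁, h₂⟩, h₃⟩, h₄⟩ := (((A.eventually_eq_ff κ
    (A.F.map l.u ≫ m.δ) (l.δ ≫ (A.F.map m.u ⊗ₘ A.F.map m.u)) (by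
      simp [← m.δ_f, ← l.δ_f])).and
    (A.eventually_eq_fg κ (A.G.map l.u ≫ m.γ) (l.γ ≫ (A.F.map m.u ⊗ₘ A.G.map m.u)) (by
      simp [← m.γ_g, ← l.γ_g]))).and
    (A.eventually_eq_fff κ (l.δ ≫ (A.F.map m.u ⊗ₘ m.δ))
      (l.δ ≫ (m.δ ⊗ₘ A.F.map m.u) ≫ (α_ _ _ _).hom) 
      (coassoc_lift l.δ_f m.δ_f m.δ_f (A.f_w _) (A.f_w _) (ComonObj.comul_assoc _)))).and
    (A.eventually_eq_ffg κ (l.γ ≫ (A.F.map m.u ⊗ₘ m.γ))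
      (l.γ ≫ (m.δ ⊗ₘ A.G.map m.u) ≫ (α_ _ _ _).hom) 
      (coassoc_lift l.γ_g m.γ_g m.δ_f (A.f_w _) (A.g_w _) T.coassoc)) |>.exists
  refine ⟨k', m.push w, ?_, ?_, ?_, ?_⟩
  · simpa using h₁
  · simpa using h₂
  · simpa only [Link.push, Functor.map_comp] using coassoc_push h₃
  · simpa only [Link.push, Functor.map_comp] using coassoc_push h₄

/-- This makes `e` and `e'` respect the first link, as needed for them to induce a comodule morphism
from `E` to the colimit of the chain. -/
lemma exists_initial_link {E : ComodTotal V} [IsCardinalPresentable E.comon.X κ]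
    [IsCardinalPresentable E.X κ] (p : E ⟶ T) {i : J} (e : E.comon.X ⟶ A.F.obj i)
    (e' : E.X ⟶ A.G.obj i) (he : e ≫ A.f i = p.base.hom) (he' : e' ≫ A.g i = p.hom) :
    ∃ (j : J) (l : A.Link i j),
      e ≫ l.δ = Δ[E.comon.X] ≫ (e ≫ A.F.map l.u ⊗ₘ e ≫ A.F.map l.u) ∧
      e' ≫ l.γ = E.coact ≫ (e ≫ A.F.map l.u ⊗ₘ e' ≫ A.G.map l.u) := by
  have := isFiltered_of_isCardinalFiltered J κ
  obtain ⟨k, ⟨m⟩⟩ := A.nonempty_link κ i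
  obtain ⟨k', w, h₁, h₂⟩ := ((A.eventually_eq_ff κ
    (e ≫ m.δ) (Δ[E.comon.X] ≫ (e ≫ A.F.map m.u ⊗ₘ e ≫ A.F.map m.u)) (by
      simp [← m.δ_f, reassoc_of% he, he])).and
    (A.eventually_eq_fg κ (e' ≫ m.γ) (E.coact ≫ (e ≫ A.F.map m.u ⊗ₘ e' ≫ A.G.map m.u)) (by
      simp [← m.γ_g, reassoc_of% he', he, he', p.hom_coact]))).exists
  refine ⟨k', m.push w, ?_, ?_⟩
  · simpa using h₁
  · simpa using h₂

/-- A stage following a given one. -/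
noncomputable def Stage.next (s : A.Stage) : A.Stage :=
  ⟨(A.exists_compatible_link κ s.link).choose_spec.choose⟩

/-- The sequence of stages starting from a given one. -/
noncomputable def stage (s : A.Stage) : ℕ → A.Stage
  | 0 => s
  | n + 1 => Stage.next A κ (stage s n)

/-- The source of stage `n + 1` is definitionally the target of stage `n`, so consecutive links
compose without transport. -/
lemma compatible_stage (s : A.Stage) (n : ℕ) :
    Link.Compatible (A := A) (A.stage κ s n).link
      (k := (A.stage κ s (n + 1)).tgt) (A.stage κ s (n + 1)).link :=
  (A.exists_compatible_link κ (A.stage κ s n).link).choose_spec.choose_spec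

/-- The chain given by a sequence of links. -/
noncomputable def chain (s : A.Stage) : ComodChain T where
  Y n := A.F.obj (A.stage κ s n).src
  Z n := A.G.obj (A.stage κ s n).src
  t n := A.F.map (A.stage κ s n).link.u
  s n := A.G.map (A.stage κ s n).link.u
  f n := A.f (A.stage κ s n).src
  g n := A.g (A.stage κ s n).src
  δ n := (A.stage κ s n).link.δ
  γ n := (A.stage κ s n).link.γ
  t_f n := A.f_w (A.stage κ s n).link.u
  s_g n := A.g_w (A.stage κ s n).link.u
  δ_f n := (A.stage κ s n).link.δ_f
  γ_g n := (A.stage κ s n).link.γ_g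
  δ_counit n := (A.stage κ s n).link.δ_counit
  δ_counit' n := (A.stage κ s n).link.δ_counit'
  γ_counit n := (A.stage κ s n).link.γ_counit
  δ_comm n := (A.compatible_stage κ s n).δ_comm
  γ_comm n := (A.compatible_stage κ s n).γ_comm
  δ_coassoc n := (A.compatible_stage κ s n).δ_coassoc
  γ_coassoc n := (A.compatible_stage κ s n).γ_coassoc

/-- `D` is the colimit of a chain starting at stage `i`. The maps `a` and `b` ensure that whatever
already lifts, or already agrees, at stage `i` does so in `D`. -/
lemma exists_factorization [HasColimitsOfSize.{v, v} V] (hκ : Cardinal.aleph0 < κ)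
    {E : ComodTotal V} [IsCardinalPresentable E.comon.X κ]
    [IsCardinalPresentable E.X κ] (p : E ⟶ T) {i : J} (e : E.comon.X ⟶ A.F.obj i)
    (e' : E.X ⟶ A.G.obj i) (he : e ≫ A.f i = p.base.hom) (he' : e' ≫ A.g i = p.hom) :
    ∃ (D : ComodTotal V) (_ : IsCardinalPresentable D.comon.X κ)
      (_ : IsCardinalPresentable D.X κ) (q : D ⟶ T) (r : E ⟶ D) (a : A.F.obj i ⟶ D.comon.X)
      (b : A.G.obj i ⟶ D.X), a ≫ q.base.hom = A.f i ∧ b ≫ q.hom = A.g i ∧ e ≫ a = r.base.hom ∧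
      e' ≫ b = r.hom ∧ r ≫ q = p := by
  obtain ⟨j, l, h₁, h₂⟩ := A.exists_initial_link κ p e e' he he'
  let c := A.chain κ ⟨l⟩
  have (n : ℕ) : IsCardinalPresentable (c.Y n) κ :=
    inferInstanceAs (IsCardinalPresentable (A.F.obj _) κ)
  have (n : ℕ) : IsCardinalPresentable (c.Z n) κ :=
    inferInstanceAs (IsCardinalPresentable (A.G.obj _) κ)
  refine ⟨c.colim, isCardinalPresentable_seqColim c.t κ hκ, isCardinalPresentable_seqColim c.s κ hκ,
    c.toTotal, c.ofInitial p e e' he h₁ h₂, seqι c.t 0, seqι c.s 0, c.ι_toComon 0,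
    seqι_desc c.s c.g c.s_g 0, rfl, rfl, ?_⟩
  ext
  · exact (Category.assoc _ _ _).trans ((congrArg (e ≫ ·) (c.ι_toComon 0)).trans he)
  · exact (Category.assoc _ _ _).trans
      ((congrArg (e' ≫ ·) (seqι_desc c.s c.g c.s_g 0)).trans he')

end

end Approximation

end Approximation

/-! ### A density criterion -/

section Density

variable {𝒯 : Type u₁} [Category.{v₁} 𝒯]

/-- The canonical cocone with point `T` on the diagram of objects over `T` satisfying `P`. -/
def canonicalCocone (P : ObjectProperty 𝒯) (T : 𝒯) :
    Cocone (CostructuredArrow.proj P.ι T ⋙ P.ι) where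
  pt := T
  ι := { app k := k.hom
         naturality _ _ w := (CostructuredArrow.w w).trans (Category.comp_id _).symm }

/-- An object of the index category of the canonical diagram. -/
abbrev overMk {P : ObjectProperty 𝒯} {T D : 𝒯} (hD : P D) (q : D ⟶ T) :
    CostructuredArrow P.ι T :=
  CostructuredArrow.mk (show P.ι.obj ⟨D, hD⟩ ⟶ T from q)

/-- A morphism in the index category of the canonical diagram. -/
abbrev overHomMk {P : ObjectProperty 𝒯} {T D E : 𝒯} (hD : P D) (hE : P E) {q : D ⟶ T} {t : E ⟶ T}
    (r : D ⟶ E) (h : r ≫ t = q) : overMk hD q ⟶ overMk hE t :=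
  CostructuredArrow.homMk (ObjectProperty.homMk r) h

variable {V : Type u} [Category.{v} V]

/-- The legs of a cocone on the image of the canonical diagram. -/
def canonicalLeg {U : 𝒯 ⥤ V} {P : ObjectProperty 𝒯} {T : 𝒯}
    (s : Cocone ((CostructuredArrow.proj P.ι T ⋙ P.ι) ⋙ U)) {D : 𝒯} (hD : P D) (q : D ⟶ T) :
    U.obj D ⟶ s.pt :=
  s.ι.app (overMk hD q)

lemma map_canonicalLeg {U : 𝒯 ⥤ V} {P : ObjectProperty 𝒯} {T : 𝒯}
    (s : Cocone ((CostructuredArrow.proj P.ι T ⋙ P.ι) ⋙ U)) {D E : 𝒯} (hD : P D) (hE : P E)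
    {q : D ⟶ T} {t : E ⟶ T} (r : D ⟶ E) (h : r ≫ t = q) :
    U.map r ≫ canonicalLeg s hE t = canonicalLeg s hD q :=
  s.w (overHomMk hD hE r h)

/-- `U.obj T` is a `κ`-filtered colimit of `κ`-presentable objects. By `lift` each leg factors
through some `D` over `T`, and by `merge` the value of a cocone on it does not depend on the
factorization. Filteredness of the canonical diagram is not required. -/
lemma nonempty_isColimit_map_canonicalCocone (κ : Cardinal.{v}) [Fact κ.IsRegular]
    [IsCardinalLocallyPresentable V κ] (U : 𝒯 ⥤ V) (P : ObjectProperty 𝒯) (T : 𝒯)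
    (hU : ∀ D, P D → IsCardinalPresentable (U.obj D) κ)
    (lift : ∀ (Y : V) [IsCardinalPresentable Y κ] (y : Y ⟶ U.obj T),
      ∃ (D : 𝒯) (_ : P D) (q : D ⟶ T) (a : Y ⟶ U.obj D), a ≫ U.map q = y)
    (merge : ∀ (D D' : 𝒯) (_ : P D) (_ : P D') (q : D ⟶ T) (q' : D' ⟶ T)
      (Y : V) [IsCardinalPresentable Y κ] (x : Y ⟶ U.obj D) (x' : Y ⟶ U.obj D'),
      x ≫ U.map q = x' ≫ U.map q' → ∃ (E : 𝒯) (_ : P E) (t : E ⟶ T) (r : D ⟶ E) (r' : D' ⟶ E),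
        r ≫ t = q ∧ r' ≫ t = q' ∧ x ≫ U.map r = x' ≫ U.map r') :
    Nonempty (IsColimit (U.mapCocone (canonicalCocone P T))) := by
  have key (s : Cocone ((CostructuredArrow.proj P.ι T ⋙ P.ι) ⋙ U))
      (D D' : 𝒯) (hD : P D) (hD' : P D') (q : D ⟶ T) (q' : D' ⟶ T)
      (Y : V) [IsCardinalPresentable Y κ] (x : Y ⟶ U.obj D) (x' : Y ⟶ U.obj D')
      (h : x ≫ U.map q = x' ≫ U.map q') :
      x ≫ canonicalLeg s hD q =
        x' ≫ canonicalLeg s hD' q' := by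
    obtain ⟨E, hE, t, r, r', hr, hr', hx⟩ := merge D D' hD hD' q q' Y x x' h
    rw [← map_canonicalLeg s hD hE r hr, ← map_canonicalLeg s hD' hE r' hr', reassoc_of% hx]
  obtain ⟨J, _, _, ⟨p⟩⟩ :=
    (isCardinalFilteredGenerator_isCardinalPresentable V κ).exists_colimitsOfShape (U.obj T)
  have hp (j : J) : IsCardinalPresentable (p.diag.obj j) κ := p.prop_diag_obj j
  let π (j : J) : p.diag.obj j ⟶ U.obj T := p.ι.app j
  have hπ {i j : J} (w : i ⟶ j) : p.diag.map w ≫ π j = π i :=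
    (p.ι.naturality w).trans (Category.comp_id _)
  choose D hD q a ha using fun j => lift (p.diag.obj j) (π j)
  let d (s : Cocone ((CostructuredArrow.proj P.ι T ⋙ P.ι) ⋙ U)) : U.obj T ⟶ s.pt :=
    p.isColimit.desc (coconeMk (fun j => a j ≫ canonicalLeg s (hD j) (q j))
      fun {i j} w => by
        rw [← Category.assoc]
        refine key s _ _ _ _ _ _ _ _ _ ?_
        rw [Category.assoc, ha, ha, hπ])
  have hd (s : Cocone ((CostructuredArrow.proj P.ι T ⋙ P.ι) ⋙ U)) (j : J) :
      π j ≫ d s = a j ≫ canonicalLeg s (hD j) (q j) :=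
    p.isColimit.fac _ j
  refine ⟨{ desc := d, fac := fun s k => ?_, uniq := fun s m hm => ?_ }⟩
  -- The object of the canonical diagram is itself presentable, so its leg factors through some `π
  -- j`, and `key` compares the two factorizations.
  · have : IsCardinalPresentable (U.obj k.left.obj) κ := hU _ k.left.2
    let k' : k.left.obj ⟶ T := k.hom
    obtain ⟨j, b, hb⟩ := IsCardinalPresentable.exists_hom_of_isColimit κ p.isColimit
      (U.map k')
    change b ≫ π j = U.map k' at hb
    change U.map k' ≫ d s = canonicalLeg s k.left.2 k'
    rw [← hb, Category.assoc, hd, ← Category.assoc]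
    refine (key s _ _ _ k.left.2 _ k' _ _ (𝟙 (U.obj k.left.obj)) ?_).trans (Category.id_comp _)
    rw [Category.assoc, ha, hb, Category.id_comp]
  · have hm' (j : J) : U.map (q j) ≫ m = canonicalLeg s (hD j) (q j) :=
      hm (overMk (hD j) (q j))
    refine p.isColimit.hom_ext fun j => ?_
    change π j ≫ m = π j ≫ d s
    rw [hd, ← hm', ← ha]
    exact Category.assoc _ _ _

end Density

/-! ### Presentable approximations exist -/

section SmallComodules

variable {V : Type u} [Category.{v} V] [MonoidalCategory V]

variable (V) in
/-- The comodules over comonoids whose underlying objects are `κ`-presentable. -/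
def smallComod (κ : Cardinal.{v}) [Fact κ.IsRegular] : ObjectProperty (ComodTotal V) :=
  fun D => IsCardinalPresentable D.comon.X κ ∧ IsCardinalPresentable D.X κ

variable (κ : Cardinal.{v}) [Fact κ.IsRegular] [IsCardinalLocallyPresentable V κ]

/-- The presentations of `C` and `X` have unrelated shapes; both are restricted to the product,
whose projections are final because the factors are filtered. -/
lemma exists_approximation (T : ComodTotal V) :
    ∃ (J : Type v) (_ : SmallCategory J) (_ : IsCardinalFiltered J κ) (A : Approximation T J),
      (∀ j, IsCardinalPresentable (A.F.obj j) κ) ∧ ∀ j, IsCardinalPresentable (A.G.obj j) κ := by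
  obtain ⟨J₁, _, _, ⟨p⟩⟩ :=
    (isCardinalFilteredGenerator_isCardinalPresentable V κ).exists_colimitsOfShape T.comon.X
  obtain ⟨J₂, _, _, ⟨q⟩⟩ :=
    (isCardinalFilteredGenerator_isCardinalPresentable V κ).exists_colimitsOfShape T.X
  have := isFiltered_of_isCardinalFiltered J₁ κ
  have := isFiltered_of_isCardinalFiltered J₂ κ
  exact ⟨J₁ × J₂, inferInstance, inferInstance,
    { F := CategoryTheory.Prod.fst J₁ J₂ ⋙ p.diag
      G := CategoryTheory.Prod.snd J₁ J₂ ⋙ q.diag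
      f j := p.ι.app j.1
      g j := q.ι.app j.2
      f_w a := (p.ι.naturality _).trans (Category.comp_id _)
      g_w a := (q.ι.naturality _).trans (Category.comp_id _)
      isColimitF := (Functor.Final.isColimitWhiskerEquiv (CategoryTheory.Prod.fst J₁ J₂) _).symm p.isColimit
      isColimitG := (Functor.Final.isColimitWhiskerEquiv (CategoryTheory.Prod.snd J₁ J₂) _).symm q.isColimit },
    fun j => p.prop_diag_obj j.1, fun j => q.prop_diag_obj j.2⟩

end SmallComodules

/-! ### Transport of structure -/

section Transport

variable {V : Type u} [Category.{v} V] [MonoidalCategory V]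

/-- An isomorphism, as a cocone on a diagram indexed by a point. -/
def isoCocone {𝒯 : Type u₁} [Category.{v₁} 𝒯] {F : Discrete PUnit.{1} ⥤ 𝒯} {Y : 𝒯}
    (e : F.obj ⟨⟨⟩⟩ ≅ Y) : Cocone F where
  pt := Y
  ι := Discrete.natTrans fun _ => e.hom

/-- An isomorphism is a colimit cocone on a diagram indexed by a point. -/
def isColimitIsoCocone {𝒯 : Type u₁} [Category.{v₁} 𝒯] {F : Discrete PUnit.{1} ⥤ 𝒯} {Y : 𝒯}
    (e : F.obj ⟨⟨⟩⟩ ≅ Y) : IsColimit (isoCocone e) where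
  desc s := e.inv ≫ s.ι.app ⟨⟨⟩⟩
  fac _ _ := e.hom_inv_id_assoc _
  uniq _ _ hm := (Iso.eq_inv_comp e).2 (hm ⟨⟨⟩⟩)

/-- Every comodule over a comonoid is isomorphic to one with prescribed isomorphic underlying
objects. -/
lemma exists_iso_of_iso (D : ComodTotal V) {C Y : V} (e₁ : D.comon.X ≅ C) (e₂ : D.X ≅ Y) :
    ∃ (c : ComonObj C) (d : ComodObj C Y),
      Nonempty (D ≅ { comon := { X := C, comon := c }, X := Y, comod := d }) := by
  -- The transported structure is the colimit of a one-object diagram, so no axiom has to be checked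
  -- again.
  let h₁ := isColimitIsoCocone
    (F := (Functor.const (Discrete PUnit.{1})).obj D ⋙ ComodTotal.forgetComon V) e₁
  let h₂ := isColimitIsoCocone
    (F := (Functor.const (Discrete PUnit.{1})).obj D ⋙ ComodTotal.forget V) e₂
  exact ⟨ComodTotal.colimitComonObj h₁, (ComodTotal.colimitObj h₁ h₂).comod,
    ⟨IsColimit.coconePointUniqueUpToIso
      (isColimitIsoCocone (F := (Functor.const (Discrete PUnit.{1})).obj D) (Iso.refl D))
      (ComodTotal.isColimitColimitCocone h₁ h₂)⟩⟩

end Transport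

/-! ### Density of the small comodules -/

section SmallComodules

variable {V : Type u} [Category.{v} V] [MonoidalCategory V]
  (κ : Cardinal.{v}) [Fact κ.IsRegular] [IsCardinalLocallyPresentable V κ]

/-- There is only a small set of `κ`-presentable objects up to isomorphism, and given objects carry
only a small set of structures. -/
instance : ObjectProperty.EssentiallySmall.{v} (smallComod V κ) := by
  obtain ⟨Q, _, _, hQ⟩ :=
    ObjectProperty.EssentiallySmall.exists_small_le.{v} (isCardinalPresentable V κ)
  refine ⟨ObjectProperty.ofObj
    (fun t : Σ (C : Subtype Q) (Y : Subtype Q) (_ : ComonObj C.1), ComodObj C.1 Y.1 =>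
      letI := t.2.2.1
      { comon := { X := t.1.1 }, X := t.2.1.1, comod := t.2.2.2 }), inferInstance, ?_⟩
  rintro D ⟨h₁, h₂⟩
  obtain ⟨C, hC, ⟨e₁⟩⟩ := hQ _ h₁
  obtain ⟨Y, hY, ⟨e₂⟩⟩ := hQ _ h₂
  obtain ⟨c, d, ⟨e⟩⟩ := exists_iso_of_iso D e₁ e₂
  exact ⟨_, ⟨(⟨⟨C, hC⟩, ⟨Y, hY⟩, c, d⟩ :
    Σ (C : Subtype Q) (Y : Subtype Q) (_ : ComonObj C.1), ComodObj C.1 Y.1)⟩, ⟨e⟩⟩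

lemma smallComod_of_isColimit {J : Type} [SmallCategory J] [FinCategory J]
    {K : J ⥤ ComodTotal V} {c : Cocone K} (hc : IsColimit c)
    (h : ∀ j, smallComod V κ (K.obj j)) : smallComod V κ c.pt := by
  have hJ : HasCardinalLT (Arrow J) κ :=
    hasCardinalLT_of_finite _ κ (Cardinal.IsRegular.aleph0_le Fact.out)
  have : HasColimitsOfSize.{0, 0} V := hasColimitsOfSizeShrink.{0, 0, v, v} V
  have (j : J) : IsCardinalPresentable ((K ⋙ ComodTotal.forgetComon V).obj j) κ := (h j).1
  have (j : J) : IsCardinalPresentable ((K ⋙ ComodTotal.forget V).obj j) κ := (h j).2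
  exact ⟨isCardinalPresentable_of_isColimit _
      (isColimitOfPreserves (ComodTotal.forgetComon V) hc) κ hJ,
    isCardinalPresentable_of_isColimit _
      (isColimitOfPreserves (ComodTotal.forget V) hc) κ hJ⟩

lemma exists_smallComod_initial :
    ∃ (E : ComodTotal V) (_ : smallComod V κ E), Nonempty (IsInitial E) := by
  have : HasColimitsOfSize.{0, 0} V := hasColimitsOfSizeShrink.{0, 0, v, v} V
  exact ⟨⊥_ (ComodTotal V), smallComod_of_isColimit κ (colimit.isColimit _) nofun, ⟨initialIsInitial⟩⟩

lemma exists_smallComod_coprod {D D' : ComodTotal V} (h : smallComod V κ D)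
    (h' : smallComod V κ D') :
    ∃ (E : ComodTotal V) (_ : smallComod V κ E) (i : D ⟶ E) (i' : D' ⟶ E),
      ∀ ⦃T : ComodTotal V⦄ (q : D ⟶ T) (q' : D' ⟶ T), ∃ p : E ⟶ T, i ≫ p = q ∧ i' ≫ p = q' := by
  have : HasColimitsOfSize.{0, 0} V := hasColimitsOfSizeShrink.{0, 0, v, v} V
  exact ⟨D ⨿ D', smallComod_of_isColimit κ (colimit.isColimit _) (by rintro ⟨_ | _⟩ <;> assumption),
    coprod.inl, coprod.inr, fun T q q' => ⟨coprod.desc q q', coprod.inl_desc _ _, coprod.inr_desc _ _⟩⟩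

variable [SymmetricCategory V] [MonoidalClosed V]

lemma exists_smallComod_lift (hκ : Cardinal.aleph0 < κ) (T : ComodTotal V)
    {Y : V} [IsCardinalPresentable Y κ] {Z : V} [IsCardinalPresentable Z κ]
    (y : Y ⟶ T.comon.X) (z : Z ⟶ T.X) :
    ∃ (D : ComodTotal V) (_ : smallComod V κ D) (q : D ⟶ T) (a : Y ⟶ D.comon.X) (b : Z ⟶ D.X),
      a ≫ q.base.hom = y ∧ b ≫ q.hom = z := by
  obtain ⟨J, _, _, A, _, _⟩ := exists_approximation κ T
  obtain ⟨E, ⟨_, _⟩, ⟨hE⟩⟩ := exists_smallComod_initial (V := V) κ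
  have := isFiltered_of_isCardinalFiltered J κ
  obtain ⟨i₀⟩ := IsFiltered.nonempty (C := J)
  -- Only `y` and `z` have to be lifted; the initial comodule fills the place of the comodule to be
  -- factored.
  let p : E ⟶ T := hE.to T
  obtain ⟨i₁, -, e, he⟩ := exists_lift (κ := κ) A.isColimitF i₀ p.base.hom
  obtain ⟨i₂, w₂, e', he'⟩ := exists_lift (κ := κ) A.isColimitG i₁ p.hom
  obtain ⟨i₃, w₃, a, ha⟩ := exists_lift (κ := κ) A.isColimitF i₂ y
  obtain ⟨i₄, w₄, b, hb⟩ := exists_lift (κ := κ) A.isColimitG i₃ z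
  change e ≫ A.f _ = _ at he
  change e' ≫ A.g _ = _ at he'
  change a ≫ A.f _ = _ at ha
  change b ≫ A.g _ = _ at hb
  obtain ⟨D, h₁, h₂, q, -, a', b', ha', hb', -⟩ := A.exists_factorization κ hκ p
    (e ≫ A.F.map (w₂ ≫ w₃ ≫ w₄)) (e' ≫ A.G.map (w₃ ≫ w₄))
    (by rw [Category.assoc, A.f_w, he]) (by rw [Category.assoc, A.g_w, he'])
  exact ⟨D, ⟨h₁, h₂⟩, q, a ≫ A.F.map w₄ ≫ a', b ≫ b',
    by rw [Category.assoc, Category.assoc, ha', A.f_w, ha], by rw [Category.assoc, hb', hb]⟩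

/-- Two parallel maps out of `κ`-presentable objects into small comodules over `T` which agree in
`T` already agree in a small comodule over `T`. -/
lemma exists_smallComod_merge (hκ : Cardinal.aleph0 < κ) {T D D' : ComodTotal V}
    (hD : smallComod V κ D) (hD' : smallComod V κ D') (q : D ⟶ T) (q' : D' ⟶ T) :
    (∀ {Y : V} [IsCardinalPresentable Y κ] (x : Y ⟶ D.comon.X) (x' : Y ⟶ D'.comon.X),
      x ≫ q.base.hom = x' ≫ q'.base.hom → ∃ (E : ComodTotal V) (_ : smallComod V κ E) (t : E ⟶ T)
        (r : D ⟶ E) (r' : D' ⟶ E), r ≫ t = q ∧ r' ≫ t = q' ∧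
          x ≫ r.base.hom = x' ≫ r'.base.hom) ∧
    (∀ {Y : V} [IsCardinalPresentable Y κ] (x : Y ⟶ D.X) (x' : Y ⟶ D'.X),
      x ≫ q.hom = x' ≫ q'.hom → ∃ (E : ComodTotal V) (_ : smallComod V κ E) (t : E ⟶ T)
        (r : D ⟶ E) (r' : D' ⟶ E), r ≫ t = q ∧ r' ≫ t = q' ∧ x ≫ r.hom = x' ≫ r'.hom) := by
  obtain ⟨J, _, _, A, _, _⟩ := exists_approximation κ T
  -- The coproduct replaces `q` and `q'` by a single morphism `p` from a small comodule.
  obtain ⟨E, ⟨_, _⟩, s, s', hE⟩ := exists_smallComod_coprod κ hD hD'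
  obtain ⟨p, rfl, rfl⟩ := hE q q'
  have := isFiltered_of_isCardinalFiltered J κ
  obtain ⟨i₀⟩ := IsFiltered.nonempty (C := J)
  obtain ⟨i₁, -, e, he⟩ := exists_lift (κ := κ) A.isColimitF i₀ p.base.hom
  obtain ⟨i₂, w₂, e', he'⟩ := exists_lift (κ := κ) A.isColimitG i₁ p.hom
  change e ≫ A.f _ = _ at he
  change e' ≫ A.g _ = _ at he'
  have key {i₃ : J} (w₃ : i₂ ⟶ i₃) := A.exists_factorization κ hκ p
    (e ≫ A.F.map (w₂ ≫ w₃)) (e' ≫ A.G.map w₃)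
    (by rw [Category.assoc, A.f_w, he]) (by rw [Category.assoc, A.g_w, he'])
  constructor
  · intro Y _ x x' h
    -- The two maps agree in `T`, hence at a later stage `i₃`; a chain started there carries the
    -- equality to its colimit.
    obtain ⟨i₃, w₃, h₃⟩ := (A.eventually_eq_f κ (x ≫ s.base.hom ≫ e ≫ A.F.map w₂)
      (x' ≫ s'.base.hom ≫ e ≫ A.F.map w₂) (by simpa [A.f_w, he] using h)).exists
    obtain ⟨D, h₁, h₂, t, r, a', b', ha', hb', hr, hr', hp⟩ := key w₃
    refine ⟨D, ⟨h₁, h₂⟩, t, s ≫ r, s' ≫ r, by rw [Category.assoc, hp],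
      by rw [Category.assoc, hp], ?_⟩
    have := h₃ =≫ a'
    simp only [Category.assoc, Functor.map_comp] at this hr
    simpa [← hr] using this
  · intro Y _ x x' h
    obtain ⟨i₃, w₃, h₃⟩ := (A.eventually_eq_g κ (x ≫ s.hom ≫ e')
      (x' ≫ s'.hom ≫ e') (by simpa [he'] using h)).exists
    obtain ⟨D, h₁, h₂, t, r, a', b', ha', hb', hr, hr', hp⟩ := key w₃
    refine ⟨D, ⟨h₁, h₂⟩, t, s ≫ r, s' ≫ r, by rw [Category.assoc, hp],
      by rw [Category.assoc, hp], ?_⟩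
    have := h₃ =≫ b'
    simp only [Category.assoc] at this hr'
    simpa [← hr'] using this

lemma nonempty_isColimit_canonicalCocone (hκ : Cardinal.aleph0 < κ) (T : ComodTotal V) :
    Nonempty (IsColimit (canonicalCocone (smallComod V κ) T)) := by
  obtain ⟨E, ⟨_, _⟩, ⟨hE⟩⟩ := exists_smallComod_initial (V := V) κ
  obtain ⟨h₁⟩ := nonempty_isColimit_map_canonicalCocone κ (ComodTotal.forgetComon V)
    (smallComod V κ) T (fun _ h => h.1)
    (fun Y _ y => by
      -- Only the comonoid component matters; the initial comodule supplies a presentable source for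
      -- the other one.
      obtain ⟨D, hD, q, a, -, ha, -⟩ := exists_smallComod_lift κ hκ T y (hE.to T).hom
      exact ⟨D, hD, q, a, ha⟩)
    (fun D D' hD hD' q q' Y _ x x' h => (exists_smallComod_merge κ hκ hD hD' q q').1 x x' h)
  obtain ⟨h₂⟩ := nonempty_isColimit_map_canonicalCocone κ (ComodTotal.forget V)
    (smallComod V κ) T (fun _ h => h.2)
    (fun Y _ y => by
      obtain ⟨D, hD, q, -, a, -, ha⟩ := exists_smallComod_lift κ hκ T (hE.to T).base.hom y
      exact ⟨D, hD, q, a, ha⟩)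
    (fun D D' hD hD' q q' Y _ x x' h => (exists_smallComod_merge κ hκ hD hD' q q').2 x x' h)
  exact ⟨ComodTotal.isColimitOfForget h₁ h₂⟩

end SmallComodules

/-! ### Limits of modules over varying monoids -/

section ModuleLimits

variable {V : Type u} [Category.{v} V] [MonoidalCategory V]

variable (V) in
/-- The functor sending `M_A` to the underlying object of `M`. -/
def ModTotal.forget : ModTotal V ⥤ V where
  obj M := M.X
  map f := f.hom

lemma comp_act_comp_aux {A B C M N L : V} {a : A ⟶ B} {b : B ⟶ C} {c : A ⟶ C} {f : M ⟶ N}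
    {g : N ⟶ L} {h : M ⟶ L} {m : A ⊗ M ⟶ M} {n : B ⊗ N ⟶ N} {l : C ⊗ L ⟶ L}
    (hab : a ≫ b = c) (hfg : f ≫ g = h) (hn : n ≫ g = b ▷ N ≫ C ◁ g ≫ l)
    (hm : m ≫ h = c ▷ M ≫ C ◁ h ≫ l) :
    (m ≫ f) ≫ g = (a ▷ M ≫ B ◁ f ≫ n) ≫ g := by
  subst hab hfg
  simp [hn, hm, whisker_exchange_assoc]

/-- A cone of modules is a limit if the cones of underlying monoids and underlying objects are. -/
def ModTotal.isLimitOfForget {J : Type u₁} [Category.{v₁} J] {K : J ⥤ ModTotal V} {c : Cone K}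
    (h₁ : IsLimit ((ModTotal.toMon V).mapCone c)) (h₂ : IsLimit ((ModTotal.forget V).mapCone c)) :
    IsLimit c where
  lift s :=
    { base := h₁.lift ((ModTotal.toMon V).mapCone s)
      hom := h₂.lift ((ModTotal.forget V).mapCone s)
      comm := h₂.hom_ext fun j => comp_act_comp_aux
        (congrArg Mon.Hom.hom (h₁.fac ((ModTotal.toMon V).mapCone s) j))
        (h₂.fac ((ModTotal.forget V).mapCone s) j) (c.π.app j).comm (s.π.app j).comm }
  fac s j := by
    ext1
    · exact h₁.fac ((ModTotal.toMon V).mapCone s) j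
    · exact h₂.fac ((ModTotal.forget V).mapCone s) j
  uniq s m hm := by
    ext1
    · exact h₁.uniq ((ModTotal.toMon V).mapCone s) m.base fun j =>
        congrArg ModTotal.Hom.base (hm j)
    · exact h₂.uniq ((ModTotal.forget V).mapCone s) m.hom fun j => congrArg ModTotal.Hom.hom (hm j)

end ModuleLimits

/-! ### The adjoint of `Hom(-, N)` -/

section RightAdjoint

variable {V : Type u} [Category.{v} V] [MonoidalCategory V] [SymmetricCategory V]
  [MonoidalClosed V] (N : ModTotal V)

open MonoidalClosed

instance {J : Type u₁} [Category.{v₁} J] [HasColimitsOfShape Jᵒᵖ V] :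
    PreservesLimitsOfShape J (homFunctor N) where
  preservesLimit {K} :=
    { preserves {c} hc := by
        have : PreservesLimitsOfShape J (ComodTotal.forgetComon V).op :=
          preservesLimitsOfShape_op _ _
        have : PreservesLimitsOfShape J (ComodTotal.forget V).op :=
          preservesLimitsOfShape_op _ _
        have h₁ : IsLimit ((Mon.forget V).mapCone
            ((ModTotal.toMon V).mapCone ((homFunctor N).mapCone c))) :=
          isLimitOfPreserves
            ((ComodTotal.forgetComon V).op ⋙ internalHom.flip.obj N.mon.X) hc
        have h₂ : IsLimit ((ModTotal.forget V).mapCone ((homFunctor N).mapCone c)) :=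
          isLimitOfPreserves ((ComodTotal.forget V).op ⋙ internalHom.flip.obj N.X) hc
        exact ⟨ModTotal.isLimitOfForget (isLimitOfReflects _ h₁) h₂⟩ }

/-- One candidate suffices: the limit in `𝒯ᵒᵖ` of all `D` in `P` equipped with a map `M ⟶ H D`.
Given `h : M ⟶ H X`, restricting `h` to each `D` over `X` selects a projection of this limit. As `X`
is the colimit of these `D`, the projections assemble to a morphism through which `h` factors. -/
lemma solutionSetCondition_of_isColimit {𝒯 : Type u₁} [Category.{v₁} 𝒯] {ℳ : Type u₂}
    [Category.{v₂} ℳ] (H : 𝒯ᵒᵖ ⥤ ℳ)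
    [HasLimitsOfSize.{v₁, v₁} 𝒯ᵒᵖ] [PreservesLimitsOfSize.{v₁, v₁} H]
    (P : ObjectProperty 𝒯) [ObjectProperty.EssentiallySmall.{v₁} P] [LocallySmall.{v₁} ℳ]
    (hP : ∀ T, Nonempty (IsColimit (canonicalCocone P T))) :
    SolutionSetCondition.{v₁} H := by
  intro M
  have hS : EssentiallySmall.{v₁} (StructuredArrow M (P.ι.op ⋙ H)) := inferInstance
  have := hasLimitsOfShape_of_essentiallySmall (StructuredArrow M (P.ι.op ⋙ H)) 𝒯ᵒᵖ
  have := preservesLimitsOfShape_of_equiv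
    (equivSmallModel.{v₁} (StructuredArrow M (P.ι.op ⋙ H))).symm H
  let F := StructuredArrow.proj M (P.ι.op ⋙ H) ⋙ P.ι.op
  let k {D : 𝒯} (hD : P D) (m : M ⟶ H.obj (op D)) : StructuredArrow M (P.ι.op ⋙ H) :=
    StructuredArrow.mk (Y := op (⟨D, hD⟩ : P.FullSubcategory)) (T := P.ι.op ⋙ H) m
  let π {D : 𝒯} (hD : P D) (m : M ⟶ H.obj (op D)) : limit F ⟶ op D := limit.π F (k hD m)
  have hπ {D E : 𝒯} (hD : P D) (hE : P E) (r : D ⟶ E) (m : M ⟶ H.obj (op E))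
      (m' : M ⟶ H.obj (op D)) (h : m ≫ H.map r.op = m') : π hE m ≫ r.op = π hD m' :=
    limit.w F (StructuredArrow.homMk (f := k hE m) (f' := k hD m')
      (Quiver.Hom.op (ObjectProperty.homMk r)) h)
  let l : M ⟶ H.obj (limit F) := (isLimitOfPreserves H (limit.isLimit F)).lift
    { pt := M
      π := { app k := k.hom
             naturality _ _ f := (Category.id_comp _).trans (StructuredArrow.w f).symm } }
  have hl {D : 𝒯} (hD : P D) (m : M ⟶ H.obj (op D)) : l ≫ H.map (π hD m) = m :=
    (isLimitOfPreserves H (limit.isLimit F)).fac _ (k hD m)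
  refine ⟨PUnit, fun _ => limit F, fun _ => l, fun X h => ⟨⟨⟩, ?_⟩⟩
  obtain ⟨hX⟩ := hP X.unop
  have := preservesLimitsOfShape_of_equiv
    (equivSmallModel.{v₁} (CostructuredArrow P.ι X.unop)ᵒᵖ).symm H
  let q (k : CostructuredArrow P.ι X.unop) : k.left.obj ⟶ X.unop := k.hom
  let d : unop X ⟶ unop (limit F) := hX.desc
    { pt := unop (limit F)
      ι := { app k := (π k.left.2 (h ≫ H.map (q k).op)).unop
             naturality k k' f := (congrArg Quiver.Hom.unop (hπ k.left.2 k'.left.2 f.left.hom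
                 (h ≫ H.map (q k').op) (h ≫ H.map (q k).op) (by
                   rw [Category.assoc, ← H.map_comp, ← op_comp]
                   exact congrArg (fun r => h ≫ H.map (Quiver.Hom.op r))
                     (CostructuredArrow.w f)))).trans (Category.comp_id _).symm } }
  have hd (k : CostructuredArrow P.ι X.unop) :
      d.op ≫ (q k).op = π k.left.2 (h ≫ H.map (q k).op) := 
    congrArg Quiver.Hom.op (hX.fac _ k)
  refine ⟨d.op, (isLimitOfPreserves H hX.op).hom_ext fun k => ?_⟩
  change (l ≫ H.map d.op) ≫ H.map (q k.unop).op = h ≫ H.map (q k.unop).op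
  rw [Category.assoc, ← H.map_comp, hd, hl]

lemma isRightAdjoint_homFunctor [IsLocallyPresentable.{v} V] : (homFunctor N).IsRightAdjoint := by
  obtain ⟨κ₀, _, _⟩ := IsLocallyPresentable.exists_cardinal.{v} V
  obtain ⟨κ, h₀, h₁, _⟩ : ∃ κ : Cardinal.{v}, κ₀ ≤ κ ∧ Cardinal.aleph0 < κ ∧ Fact κ.IsRegular := by
    have : Cardinal.aleph0 ≤ κ₀ := Cardinal.IsRegular.aleph0_le Fact.out
    -- `κ₀` may be countable; its successor is regular and uncountable, and local presentability
    -- passes to larger regular cardinals.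
    exact ⟨Order.succ κ₀, Order.le_succ _, this.trans_lt (Order.lt_succ _),
      ⟨Cardinal.isRegular_succ this⟩⟩
  have : IsCardinalLocallyPresentable V κ := .of_le V h₀
  have : HasLimits (ComodTotal V)ᵒᵖ := hasLimits_op_of_hasColimits
  have : PreservesLimitsOfSize.{v, v} (homFunctor N) := { }
  exact isRightAdjoint_of_preservesLimits_of_solutionSetCondition _
    (solutionSetCondition_of_isColimit _ (smallComod V κ)
      (nonempty_isColimit_canonicalCocone κ h₁))

end RightAdjoint

/-! ### Initial comodules and modules -/

section Initial

variable {V : Type u} [Category.{v} V] [MonoidalCategory V] [HasInitial V]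

variable (V) in
/-- The functor sending a comonoid `C` to the initial object, as a comodule over `C`. -/
noncomputable def initialComod : Comon V ⥤ ComodTotal V where
  obj C :=
    { comon := C
      X := ⊥_ V
      comod :=
        { coact := initial.to _
          counit_coact := initial.hom_ext _ _
          coassoc := initial.hom_ext _ _ } }
  map g :=
    { base := g
      hom := 𝟙 _
      comm := initial.hom_ext _ _ }

lemma exists_initialComod_hom {C : Comon V} {Y : ComodTotal V} (g : C ⟶ Y.comon) :
    ∃ f : (initialComod V).obj C ⟶ Y, f.base = g :=
  ⟨{ base := g
     hom := initial.to _
     comm := initial.hom_ext _ _ }, rfl⟩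

variable (V) in
/-- Initial comodules are left adjoint to the forgetful functor to comonoids. -/
noncomputable def initialComodAdj : initialComod V ⊣ ComodTotal.toComon V :=
  Adjunction.mkOfHomEquiv
    { homEquiv _ _ :=
        { toFun f := f.base
          invFun g :=
            { base := g
              hom := initial.to _
              comm := initial.hom_ext _ _ }
          left_inv _ := ComodTotal.hom_ext rfl (initial.hom_ext _ _)
          right_inv _ := rfl }
      homEquiv_naturality_left_symm _ _ := ComodTotal.hom_ext rfl (initial.hom_ext _ _)
      homEquiv_naturality_right _ _ := rfl }

variable [MonoidalClosed V]

lemma tensor_initial_hom_ext {A X : V} (f g : A ⊗ ⊥_ V ⟶ X) : f = g :=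
  MonoidalClosed.curry_injective (initial.hom_ext _ _)

variable (V) in
/-- The functor sending a monoid `A` to the initial object, as a module over `A`. -/
noncomputable def initialMod : Mon V ⥤ ModTotal V where
  obj A :=
    { mon := A
      X := ⊥_ V
      mod :=
        { smul := MonoidalClosed.uncurry (initial.to _)
          one_smul := tensor_initial_hom_ext (A := 𝟙_ V) _ _
          mul_smul := tensor_initial_hom_ext (A := A.X ⊗ A.X) _ _ } }
  map g :=
    { base := g
      hom := 𝟙 _
      comm := tensor_initial_hom_ext _ _ }
  map_comp _ _ := ModTotal.hom_ext rfl (initial.hom_ext _ _)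

variable (V) in
/-- Initial modules are left adjoint to the forgetful functor to monoids. -/
noncomputable def initialModAdj : initialMod V ⊣ ModTotal.toMon V :=
  Adjunction.mkOfHomEquiv
    { homEquiv _ _ :=
        { toFun f := f.base
          invFun g :=
            { base := g
              hom := initial.to _
              comm := tensor_initial_hom_ext _ _ }
          left_inv _ := ModTotal.hom_ext rfl (initial.hom_ext _ _)
          right_inv _ := rfl }
      homEquiv_naturality_left_symm _ _ := ModTotal.hom_ext rfl (initial.hom_ext _ _)
      homEquiv_naturality_right _ _ := rfl }

end Initial

/-! ### The universal measuring comonoid -/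

section MeasuringComonoid

lemma hom_ihom_initial_ext {V : Type u} [Category.{v} V] [MonoidalCategory V] [BraidedCategory V]
    [MonoidalClosed V] [HasInitial V] {M A : V} (f g : M ⟶ (ihom (⊥_ V)).obj A) : f = g :=
  MonoidalClosed.uncurry_injective
    ((cancel_epi (β_ _ _).hom).1 (tensor_initial_hom_ext (V := V) _ _))

variable {V : Type u} [Category.{v} V] [MonoidalCategory V] [SymmetricCategory V]
  [MonoidalClosed V] (N : ModTotal V)

/-- `[-, B]` sends `C` to the monoid of `Hom(0_C, N)`. Here `C ↦ 0_C` is left adjoint to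
`ComodTotal.toComon`, so its opposite is a right adjoint, and `ModTotal.toMon` is right adjoint to
`initialMod`. -/
lemma isRightAdjoint_convMonFunctor [HasInitial V] [(homFunctor N).IsRightAdjoint] :
    (convMonFunctor N.mon).IsRightAdjoint := by
  have : (initialComod V).op.IsRightAdjoint := (initialComodAdj V).op.isRightAdjoint
  have : (ModTotal.toMon V).IsRightAdjoint := (initialModAdj V).isRightAdjoint
  exact inferInstanceAs ((initialComod V).op ⋙ homFunctor N ⋙ ModTotal.toMon V).IsRightAdjoint

end MeasuringComonoid

/-! ### Corestriction of comodules -/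

section Corestriction

variable {V : Type u} [Category.{v} V] [MonoidalCategory V]

/-- Corestriction of a comodule along a morphism of comonoids. -/
def ComodTotal.corestrict (D : ComodTotal V) {C : Comon V} (g : D.comon ⟶ C) : ComodTotal V where
  comon := C
  X := D.X
  comod :=
    { coact := D.coact ≫ g.hom ▷ D.X
      counit_coact := by
        rw [Category.assoc, ← comp_whiskerRight, IsComonHom.hom_counit, D.counit_coact]
      coassoc := by
        rw [Category.assoc, Category.assoc, ← comp_whiskerRight_assoc, IsComonHom.hom_comul,
          MonoidalCategory.whiskerLeft_comp, ← whisker_exchange_assoc,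
          reassoc_of% D.coassoc]
        simp [MonoidalCategory.tensorHom_def] }

lemma corestrict_comm_aux {C C' X : V} (d : X ⟶ C ⊗ X) (g : C ⟶ C') :
    𝟙 X ≫ d ≫ g ▷ X = d ≫ g ▷ X ≫ C' ◁ 𝟙 X := by
  simp

lemma corestrict_comm_symm_aux {C C' X : V} (d : X ⟶ C ⊗ X) {g : C ⟶ C'} {g' : C' ⟶ C}
    (h : g ≫ g' = 𝟙 C) : 𝟙 X ≫ d = (d ≫ g ▷ X) ≫ g' ▷ X ≫ C ◁ 𝟙 X := by
  simp only [Category.assoc, MonoidalCategory.whiskerLeft_id, Category.comp_id, Category.id_comp,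
    ← comp_whiskerRight, h, id_whiskerRight]

/-- A comodule is isomorphic to its corestriction along an isomorphism of comonoids. -/
def ComodTotal.isoCorestrict (D : ComodTotal V) {C : Comon V} (g : D.comon ≅ C) :
    D ≅ D.corestrict g.hom where
  hom :=
    { base := g.hom
      hom := 𝟙 D.X
      comm := corestrict_comm_aux _ _ }
  inv :=
    { base := g.inv
      hom := 𝟙 D.X
      comm := corestrict_comm_symm_aux _ (congrArg Comon.Hom.hom g.hom_inv_id) }
  hom_inv_id := ComodTotal.hom_ext g.hom_inv_id (Category.id_comp _)
  inv_hom_id := ComodTotal.hom_ext g.inv_hom_id (Category.id_comp _)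

end Corestriction

/-! ### Universal measuring comodules over a prescribed `P` -/

section UniversalMeasuring

variable {V : Type u} [Category.{v} V] [MonoidalCategory V] [SymmetricCategory V]
  [MonoidalClosed V] {N : ModTotal V}

/-- The underlying morphism of monoids of a morphism into `Hom(X, N)`, in the opposite category. -/
def baseHom {X : ComodTotal V} {M : (ModTotal V)ᵒᵖ} (m : (homFunctor N).rightOp.obj X ⟶ M) :
    (convMonFunctor N.mon).rightOp.obj X.comon ⟶ op M.unop.mon :=
  m.unop.base.op

lemma baseHom_map_comp {X' X : ComodTotal V} {M : (ModTotal V)ᵒᵖ} (f : X' ⟶ X)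
    (m : (homFunctor N).rightOp.obj X ⟶ M) :
    baseHom ((homFunctor N).rightOp.map f ≫ m) =
      (convMonFunctor N.mon).rightOp.map f.base ≫ baseHom m :=
  rfl

lemma baseHom_comp {X : ComodTotal V} {M M' : (ModTotal V)ᵒᵖ}
    (m : (homFunctor N).rightOp.obj X ⟶ M) (f : M ⟶ M') :
    baseHom (m ≫ f) = baseHom m ≫ f.unop.base.op :=
  rfl

/-- `[0, N]` is terminal, so the module component exists, is unique and is automatically compatible
with the actions. -/
lemma baseHom_initialComod_bijective [HasInitial V] (C : Comon V) (M : (ModTotal V)ᵒᵖ) :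
    Function.Bijective (baseHom (N := N) (X := (initialComod V).obj C) (M := M)) :=
  ⟨fun _ _ h => Quiver.Hom.unop_inj (ModTotal.hom_ext (congrArg Quiver.Hom.unop h)
      (hom_ihom_initial_ext _ _)),
    fun g => ⟨Quiver.Hom.op
      { base := g.unop
        hom := MonoidalClosed.curry ((β_ _ _).hom ≫ MonoidalClosed.uncurry (initial.to _))
        comm := hom_ihom_initial_ext _ _ }, rfl⟩⟩

variable {R : (ModTotal V)ᵒᵖ ⥤ ComodTotal V} (adj : (homFunctor N).rightOp ⊣ R)
  {P : (Mon V)ᵒᵖ ⥤ Comon V} (adjP : (convMonFunctor N.mon).rightOp ⊣ P)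

/-- The comparison between the comonoid of the universal measuring comodule and the universal
measuring comonoid. -/
def comparison (M : (ModTotal V)ᵒᵖ) : (R.obj M).comon ⟶ P.obj (op M.unop.mon) :=
  adjP.homEquiv _ _ (baseHom ((adj.homEquiv (R.obj M) M).symm (𝟙 _)))

lemma base_comparison {X : ComodTotal V} {M : (ModTotal V)ᵒᵖ}
    (m : (homFunctor N).rightOp.obj X ⟶ M) :
    (adj.homEquiv X M m).base ≫ comparison adj adjP M = adjP.homEquiv _ _ (baseHom m) := by
  rw [comparison, ← Adjunction.homEquiv_naturality_left, ← baseHom_map_comp,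
    ← Adjunction.homEquiv_naturality_left_symm, Category.comp_id, Equiv.symm_apply_apply]

/-- By Yoneda: maps from `C` to the comonoid of `R M` extend to maps `0_C ⟶ R M`, hence correspond
to maps from `Hom(0_C, N)` to `M` in `Modᵒᵖ`. Those are monoid maps `A ⟶ [C, B]`, that is, maps from
`C` to `P A`. -/
instance [HasInitial V] (M : (ModTotal V)ᵒᵖ) : IsIso (comparison adj adjP M) := by
  refine isIso_of_yoneda_map_bijective _ fun C => ⟨fun g g' h => ?_, fun h => ?_⟩
  · obtain ⟨f, rfl⟩ := exists_initialComod_hom g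
    obtain ⟨f', rfl⟩ := exists_initialComod_hom g'
    obtain ⟨m, rfl⟩ := (adj.homEquiv _ M).surjective f
    obtain ⟨m', rfl⟩ := (adj.homEquiv _ M).surjective f'
    have h' := (base_comparison adj adjP m).symm.trans (h.trans (base_comparison adj adjP m'))
    rw [(baseHom_initialComod_bijective C M).1 ((adjP.homEquiv _ _).injective h')]
  · obtain ⟨g, rfl⟩ := (adjP.homEquiv C (op M.unop.mon)).surjective h
    obtain ⟨m, rfl⟩ := (baseHom_initialComod_bijective C M).2 g
    exact ⟨_, base_comparison adj adjP m⟩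

variable [HasInitial V]

/-- The universal measuring comodule, as a comodule over the given universal measuring
comonoid. -/
noncomputable abbrev measuringComodule (M : (ModTotal V)ᵒᵖ) : ComodTotal V :=
  (R.obj M).corestrict (asIso (comparison adj adjP M)).hom

/-- The universal property of the universal measuring comodule. -/
noncomputable def measuringEquiv (X : ComodTotal V) (M : (ModTotal V)ᵒᵖ) :
    ((homFunctor N).rightOp.obj X ⟶ M) ≃ (X ⟶ measuringComodule adj adjP M) :=
  (adj.homEquiv X M).trans ((R.obj M).isoCorestrict (asIso (comparison adj adjP M))).homToEquiv

/-- After corestriction, transposing above and taking the base is exactly transposing below; the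
unit, counit and functoriality statements all reduce to this. -/
lemma measuringEquiv_base {X : ComodTotal V} {M : (ModTotal V)ᵒᵖ}
    (m : (homFunctor N).rightOp.obj X ⟶ M) :
    (measuringEquiv adj adjP X M m).base = adjP.homEquiv _ _ (baseHom m) :=
  base_comparison adj adjP m

lemma measuringEquiv_naturality (X' X : ComodTotal V) (M : (ModTotal V)ᵒᵖ) (f : X' ⟶ X)
    (m : (homFunctor N).rightOp.obj X ⟶ M) :
    measuringEquiv adj adjP X' M ((homFunctor N).rightOp.map f ≫ m) =
      f ≫ measuringEquiv adj adjP X M m := by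
  change adj.homEquiv _ _ _ ≫ _ = f ≫ adj.homEquiv _ _ _ ≫ _
  rw [Adjunction.homEquiv_naturality_left, Category.assoc]

lemma baseHom_measuringEquiv_symm_id (M : (ModTotal V)ᵒᵖ) :
    baseHom ((measuringEquiv adj adjP _ M).symm (𝟙 _)) = adjP.counit.app (op M.unop.mon) := by
  apply (adjP.homEquiv _ _).injective
  rw [← measuringEquiv_base adj adjP, Equiv.apply_symm_apply]
  exact (((adjP.homEquiv_apply _ _ _)).trans (adjP.right_triangle_components _)).symm

/-- The universal measuring comodule functor. -/
noncomputable def measuringFunctor : (ModTotal V)ᵒᵖ ⥤ ComodTotal V :=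
  Adjunction.rightAdjointOfEquiv (measuringEquiv adj adjP) (measuringEquiv_naturality adj adjP)

/-- The adjunction between the functors `Hom(-, N)` and `Q(-, N)`. -/
noncomputable def measuringAdj : (homFunctor N).rightOp ⊣ measuringFunctor adj adjP :=
  Adjunction.adjunctionOfEquivRight (measuringEquiv adj adjP) (measuringEquiv_naturality adj adjP)

lemma measuringFunctor_map_base {M M' : (ModTotal V)ᵒᵖ} (f : M ⟶ M') :
    ((measuringFunctor adj adjP).map f).base = P.map f.unop.base.op := by
  change (measuringEquiv adj adjP (measuringComodule adj adjP M) M'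
    ((measuringEquiv adj adjP _ M).symm (𝟙 _) ≫ f)).base = _
  rw [measuringEquiv_base, baseHom_comp, baseHom_measuringEquiv_symm_id]
  exact (adjP.homEquiv_naturality_right _ _).trans
    ((congrArg (· ≫ P.map f.unop.base.op) ((adjP.homEquiv_apply _ _ _).trans
      (adjP.right_triangle_components _))).trans (Category.id_comp _))

lemma liesOver_measuringAdj :
    LiesOver (ComodTotal.toComon V) (ModTotal.toMon V).op (measuringAdj adj adjP) adjP where
  left_comm := rfl
  -- The corestricted comodule has comonoid `P A` by definition, so the `eqToHom` terms here and
  -- below are identities.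
  right_comm := CategoryTheory.Functor.ext (fun M => Eq.refl (P.obj (op M.unop.mon))) fun _ _ f =>
    (measuringFunctor_map_base adj adjP f).trans
      ((Category.id_comp _).trans (Category.comp_id _)).symm
  unit_over X :=
    (measuringEquiv_base adj adjP (𝟙 ((homFunctor N).rightOp.obj X))).trans
      ((adjP.homEquiv_id _).trans (Category.comp_id _).symm)
  counit_over M :=
    (baseHom_measuringEquiv_symm_id adj adjP M).trans (Category.id_comp _).symm

end UniversalMeasuring

end MeasuringComodule

theorem mainTheorem2 {V : Type u} [Category.{v} V] [MonoidalCategory V]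
    [SymmetricCategory V] [MonoidalClosed V] [IsLocallyPresentable.{v} V]
    (N : MeasuringComodule.ModTotal V) :
    (MeasuringComodule.convMonFunctor N.mon).rightOp.IsLeftAdjoint ∧
    ∀ (P : (Mon V)ᵒᵖ ⥤ Comon V)
      (adjP : (MeasuringComodule.convMonFunctor N.mon).rightOp ⊣ P),
      ∃ (Q : (MeasuringComodule.ModTotal V)ᵒᵖ ⥤ MeasuringComodule.ComodTotal V)
        (adjQ : (MeasuringComodule.homFunctor N).rightOp ⊣ Q),
        MeasuringComodule.LiesOver (MeasuringComodule.ComodTotal.toComon V)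
          (MeasuringComodule.ModTotal.toMon V).op adjQ adjP ∧
        ∀ M : MeasuringComodule.ModTotal V, (Q.obj (op M)).comon = P.obj (op M.mon) := by
  obtain ⟨κ, _, _⟩ := IsLocallyPresentable.exists_cardinal.{v} V
  -- This provides the initial object of `V`.
  have := Limits.hasColimitsOfSizeShrink.{0, 0, v, v} V
  have := MeasuringComodule.isRightAdjoint_homFunctor N
  have := MeasuringComodule.isRightAdjoint_convMonFunctor N
  let adj := Adjunction.ofIsLeftAdjoint (MeasuringComodule.homFunctor N).rightOp
  exact ⟨inferInstance, fun P adjP => ⟨_, MeasuringComodule.measuringAdj adj adjP,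
    MeasuringComodule.liesOver_measuringAdj adj adjP, fun _ => rfl⟩⟩
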